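/- Let $n\ge 1$ be an integer and let $\sigma\ge 1$, $0<\delta_1<\sigma/2$, $s\ge 0$, $j\in\{0,1\}$, $n>4\delta_1$. Consider the Cauchy problem on $\mathbb{R}^n$ $$u_{tt}+(-\Delta)^{\sigma}u+(-\Delta)^{\delta_1}u_t=0,\qquad u(0,\cdot)=u_0,\quad u_t(0,\cdot)=u_1,$$ with data $u_0\in L^1\cap H^{s+j\sigma}$ and $u_1\in L^1\cap H^{[s+(j-1)\sigma]^+}$, where $[a]^+=\max\{a,0\}$. Put $P_1=\int_{\mathbb{R}^n}u_1(x)\,dx$ and $$G(t,\cdot)=\mathfrak{F}^{-1}\Big(\frac{e^{-t|\xi|^{2(\sigma-\delta_1)}}}{|\xi|^{2\delta_1}}\Big),\qquad t>0,$$ where $\mathfrak{F}^{-1}$ is the inverse of $\mathfrak{F}f(\xi)=\int_{\mathbb{R}^n} e^{-ix\cdot\xi}f(x)\,dx$, and let $|D|^s$ be the Fourier multiplier with symbol $|\xi|^s$. Let $u\in C([0,\infty);L^2(\mathbb{R}^n))$ be a solution of the Cauchy problem, meaning that $u(0)=u_0$ and that, for every Schwartz function $\varphi$, with $\langle\cdot,\cdot\rangle$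 the $L^2$ inner product, $t\mapsto\langle\varphi,u(t)\rangle$ is $C^2$ and $t\mapsto\langle(-\Delta)^{\delta_1}\varphi,u(t)\rangle$ is $C^1$ on $[0,\infty)$, $\frac{d}{dt}\langle\varphi,u(t)\rangle|_{t=0}=\langle\varphi,u_1\rangle$, and $$\frac{d^2}{dt^2}\langle\varphi,u(t)\rangle+\langle(-\Delta)^{\sigma}\varphi,u(t)\rangle+\frac{d}{dt}\langle(-\Delta)^{\delta_1}\varphi,u(t)\rangle=0\qquad(t\ge 0).$$ Then $|D|^su(t,\cdot)$ and $|D|^sG(t,\cdot)$ belong to $L^2$ for all $t>0$ and are $C^j$ functions of $t\in(0,\infty)$ with values in $L^2$, and, as $t\to\infty$, $$\Big\|\partial_t^j|D|^s\big(u(t,\cdot)-P_1\,G(t,\cdot)\big)\Big\|_{L^2}=o\Big(t^{-\frac{n}{4(\sigma-\delta_1)}-\frac{s}{2(\sigma-\delta_1)}-j+\frac{\delta_1}{\sigma-\delta_1}}\Big).$$ Moreover, if $P_1\ne 0$, then there are constants $C_1,C_2>0$ such that, for all sufficiently large $t$, $$C_1\,t^{-\frac{n}{4(\sigma-\delta_1)}-\frac{s}{2(\sigma-\delta_1)}-j+\frac{\delta_1}{\sigma-\delta_1}}\le\big\|\partial_t^j|D|^su(t,\cdot)\big\|_{L^2}\le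 C_2\,t^{-\frac{n}{4(\sigma-\delta_1)}-\frac{s}{2(\sigma-\delta_1)}-j+\frac{\delta_1}{\sigma-\delta_1}}.$$ -/

import Mathlib

open MeasureTheory Filter Topology Set
open scoped FourierTransform SchwartzMap

noncomputable section

/-- The Hilbert space `L²(ℝⁿ; ℂ)`. -/
abbrev L2 (n : ℕ) : Type := Lp ℂ 2 (volume : Measure (EuclideanSpace ℝ (Fin n)))

/-- The function `ξ ↦ (2π|ξ|)^s · 𝓕 f(ξ)`. Mathlib's Fourier transform uses the kernel
`exp(-2πi⟨x, ξ⟩)`, so in this normalization the operator `|D|` has symbol `2π|ξ|`. -/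
def absDMultiplied {n : ℕ} (s : ℝ) (f : L2 n) : EuclideanSpace ℝ (Fin n) → ℂ :=
  fun ξ => (((2 * Real.pi * ‖ξ‖) ^ s : ℝ) : ℂ) * (𝓕 f : L2 n) ξ

/-- `f ∈ L²` lies in the domain of `|D|^s` on `L²`, that is, `|D|^s f ∈ L²`. -/
def InDomAbsD {n : ℕ} (s : ℝ) (f : L2 n) : Prop :=
  MemLp (absDMultiplied s f) 2 volume

open Classical in
/-- The operator `|D|^s = (-Δ)^{s/2}` on `L²` (value `0` outside of its domain). -/
def absD {n : ℕ} (s : ℝ) (f : L2 n) : L2 n :=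
  if h : InDomAbsD s f then 𝓕⁻ (MemLp.toLp (absDMultiplied s f) h) else 0

/-- The fractional Laplacian `(-Δ)^a = |D|^{2a}` on `L²`. -/
def fracLaplacian {n : ℕ} (a : ℝ) (f : L2 n) : L2 n := absD (2 * a) f

/-- Defining property of `|D|^s` on its domain. -/
theorem fourier_absD {n : ℕ} {s : ℝ} {f : L2 n} (h : InDomAbsD s f) :
    ((𝓕 (absD s f) : L2 n) : EuclideanSpace ℝ (Fin n) → ℂ) =ᵐ[volume]
      fun ξ => (((2 * Real.pi * ‖ξ‖) ^ s : ℝ) : ℂ) * (𝓕 f : L2 n) ξ := by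
  have h1 : (𝓕 (absD s f) : L2 n) = MemLp.toLp (absDMultiplied s f) h := by
    rw [absD, dif_pos h]
    exact FourierTransform.fourier_fourierInv_eq _
  rw [h1]
  exact MemLp.coeFn_toLp h

/-- Schwartz functions lie in the domain of `|D|^s` for every `s ≥ 0`. -/
theorem inDomAbsD_schwartz {n : ℕ} {s : ℝ} (hs : 0 ≤ s) (φ : 𝓢(EuclideanSpace ℝ (Fin n), ℂ)) :
    InDomAbsD s (φ.toLp 2 volume) := by
  have hae : ((𝓕 (φ.toLp 2 volume) : L2 n) : EuclideanSpace ℝ (Fin n) → ℂ) =ᵐ[volume]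
      ((𝓕 φ : 𝓢(EuclideanSpace ℝ (Fin n), ℂ)) : EuclideanSpace ℝ (Fin n) → ℂ) := by
    rw [SchwartzMap.toLp_fourier_eq]
    exact SchwartzMap.coeFn_toLp _ _ _
  have hg : (fun x : EuclideanSpace ℝ (Fin n) =>
      (((1 + ‖x‖ ^ 2) ^ (s / 2) : ℝ) : ℂ)).HasTemperateGrowth := by fun_prop
  have hm := (SchwartzMap.smulLeftCLM ℂ (fun x : EuclideanSpace ℝ (Fin n) =>
      (((1 + ‖x‖ ^ 2) ^ (s / 2) : ℝ) : ℂ)) (𝓕 φ)).memLp 2 volume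
  refine (hm.const_mul ((((2 * Real.pi) ^ s : ℝ)) : ℂ)).of_le ?_ ?_
  · refine AEStronglyMeasurable.mul ?_ (Lp.aestronglyMeasurable _)
    refine (Complex.measurable_ofReal.comp ?_).aestronglyMeasurable
    exact (measurable_norm.const_mul _).pow_const s
  · filter_upwards [hae] with ξ hξ
    have hpi := Real.pi_pos
    rw [absDMultiplied, hξ, norm_mul, norm_mul, SchwartzMap.smulLeftCLM_apply_apply hg, norm_smul,
      ← mul_assoc, Complex.norm_real, Complex.norm_real, Complex.norm_real,
      Real.norm_of_nonneg (by positivity), Real.norm_of_nonneg (by positivity),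
      Real.norm_of_nonneg (by positivity), Real.mul_rpow (by positivity) (by positivity)]
    refine mul_le_mul_of_nonneg_right (mul_le_mul_of_nonneg_left ?_ (by positivity)) (norm_nonneg _)
    have h2 : ‖ξ‖ ^ s = (‖ξ‖ ^ 2) ^ (s / 2) := by
      rw [← Real.rpow_natCast, ← Real.rpow_mul (norm_nonneg _)]
      congr 1
      push_cast
      ring
    rw [h2]
    exact Real.rpow_le_rpow (by positivity) (by linarith) (by linarith)

/-- `u : [0, ∞) → L²(ℝⁿ)` is a (weak, continuous-in-time) solution of
`u_tt + (-Δ)^σ u + (-Δ)^{δ₁} u_t = 0`, `u(0) = u₀`, `u_t(0) = u₁`: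
the equation and the initial condition for `u_t` are tested against all Schwartz functions.
Only the values `u t` with `t ≥ 0` matter. -/
structure IsSobolevSolution {n : ℕ} (σ δ₁ : ℝ) (u₀ u₁ : L2 n) (u : ℝ → L2 n) : Prop where
  continuousOn : ContinuousOn u (Ici 0)
  initial_value : u 0 = u₀
  contDiffOn : ∀ φ : 𝓢(EuclideanSpace ℝ (Fin n), ℂ),
    ContDiffOn ℝ 2 (fun t => inner ℂ (φ.toLp 2 volume) (u t)) (Ici 0)
  contDiffOn_damping : ∀ φ : 𝓢(EuclideanSpace ℝ (Fin n), ℂ),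
    ContDiffOn ℝ 1 (fun t => inner ℂ (fracLaplacian δ₁ (φ.toLp 2 volume)) (u t)) (Ici 0)
  initial_velocity : ∀ φ : 𝓢(EuclideanSpace ℝ (Fin n), ℂ),
    derivWithin (fun t => inner ℂ (φ.toLp 2 volume) (u t)) (Ici 0) 0
      = inner ℂ (φ.toLp 2 volume) u₁
  equation : ∀ φ : 𝓢(EuclideanSpace ℝ (Fin n), ℂ), ∀ t : ℝ, 0 ≤ t →
    iteratedDerivWithin 2 (fun τ => inner ℂ (φ.toLp 2 volume) (u τ)) (Ici 0) t
      + inner ℂ (fracLaplacian σ (φ.toLp 2 volume)) (u t)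
      + derivWithin (fun τ => inner ℂ (fracLaplacian δ₁ (φ.toLp 2 volume)) (u τ)) (Ici 0) t = 0

/-- The symbol `exp(-t|ζ|^{2(σ-δ₁)}) / |ζ|^{2δ₁}` at the frequency `ζ = 2πξ`. -/
def profileSymbol (n : ℕ) (σ δ₁ t : ℝ) (ξ : EuclideanSpace ℝ (Fin n)) : ℂ :=
  ((Real.exp (-t * (2 * Real.pi * ‖ξ‖) ^ (2 * (σ - δ₁))) / (2 * Real.pi * ‖ξ‖) ^ (2 * δ₁) : ℝ) : ℂ)

open Classical in
/-- The function `x ↦ (2π)^{-n} ∫ exp(i⟨x, ζ⟩) exp(-t|ζ|^{2(σ-δ₁)}) / |ζ|^{2δ₁} dζ` of `L²(ℝⁿ)`,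
the inverse Fourier transform (inverse to `f ↦ ∫ exp(-i⟨x, ζ⟩) f(x) dx`) of
`exp(-t|ζ|^{2(σ-δ₁)}) / |ζ|^{2δ₁}`. The symbol is square integrable for `t > 0` if `n > 4δ₁`. -/
def profile (n : ℕ) (σ δ₁ t : ℝ) : L2 n :=
  if h : MemLp (profileSymbol n σ δ₁ t) 2 volume then
    𝓕⁻ (MemLp.toLp (profileSymbol n σ δ₁ t) h) else 0

theorem memLp_profileSymbol {n : ℕ} {σ δ₁ t : ℝ} (hδ : 0 < δ₁) (hσ : δ₁ < σ / 2)
    (hn : 4 * δ₁ < n) (ht : 0 < t) : MemLp (profileSymbol n σ δ₁ t) 2 volume := by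
  have hpi := Real.pi_pos
  have hn0 : 0 < n := by
    have : (0 : ℝ) < n := by linarith
    exact_mod_cast this
  have : Nonempty (Fin n) := ⟨⟨0, hn0⟩⟩
  have hmeas : AEStronglyMeasurable (profileSymbol n σ δ₁ t) volume := by
    refine (Complex.measurable_ofReal.comp ?_).aestronglyMeasurable
    refine Measurable.div (Real.measurable_exp.comp (Measurable.const_mul ?_ _)) ?_
    · exact (measurable_norm.const_mul _).pow_const _
    · exact (measurable_norm.const_mul _).pow_const _
  rw [memLp_two_iff_integrable_sq_norm hmeas]
  have hfun : (fun ξ => ‖profileSymbol n σ δ₁ t ξ‖ ^ 2) = fun ξ : EuclideanSpace ℝ (Fin n) =>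
      (fun r : ℝ => (Real.exp (-t * (2 * Real.pi * r) ^ (2 * (σ - δ₁)))
        / (2 * Real.pi * r) ^ (2 * δ₁)) ^ 2) ‖ξ‖ := by
    funext ξ
    rw [profileSymbol, Complex.norm_real, Real.norm_eq_abs, sq_abs]
  rw [hfun, integrable_fun_norm_addHaar volume (f := fun r : ℝ =>
    (Real.exp (-t * (2 * Real.pi * r) ^ (2 * (σ - δ₁))) / (2 * Real.pi * r) ^ (2 * δ₁)) ^ 2)]
  have hbase := (integrableOn_rpow_mul_exp_neg_mul_rpow (p := 2 * (σ - δ₁))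
    (s := (n : ℝ) - 1 - 4 * δ₁) (b := 2 * t * (2 * Real.pi) ^ (2 * (σ - δ₁)))
    (by linarith) (by linarith) (by positivity)).const_mul ((2 * Real.pi) ^ (-(4 * δ₁)))
  refine (integrableOn_congr_fun ?_ measurableSet_Ioi).1 hbase
  intro r hr
  have hr : 0 < r := hr
  simp only [finrank_euclideanSpace, Fintype.card_fin, smul_eq_mul]
  rw [div_pow, ← Real.exp_nat_mul, ← Real.rpow_mul_natCast (by positivity),
    Real.mul_rpow (by positivity) hr.le, Real.mul_rpow (by positivity) hr.le, sub_sub,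
    add_comm 1, ← sub_sub, sub_right_comm, Real.rpow_sub hr, Real.rpow_neg (by positivity),
    ← Real.rpow_natCast, Nat.cast_sub (by omega)]
  have e : 2 * δ₁ * ((2 : ℕ) : ℝ) = 4 * δ₁ := by push_cast; ring
  rw [e]
  have e2 : ((2 : ℕ) : ℝ) * (-t * ((2 * Real.pi) ^ (2 * (σ - δ₁)) * r ^ (2 * (σ - δ₁))))
      = -(2 * t * (2 * Real.pi) ^ (2 * (σ - δ₁))) * r ^ (2 * (σ - δ₁)) := by push_cast; ring
  rw [e2]
  push_cast
  field_simp

/-- For the parameters of interest the profile has the prescribed Fourier transform. -/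
theorem fourier_profile {n : ℕ} {σ δ₁ t : ℝ} (hδ : 0 < δ₁) (hσ : δ₁ < σ / 2)
    (hn : 4 * δ₁ < n) (ht : 0 < t) :
    ((𝓕 (profile n σ δ₁ t) : L2 n) : EuclideanSpace ℝ (Fin n) → ℂ) =ᵐ[volume]
      profileSymbol n σ δ₁ t := by
  have h := memLp_profileSymbol hδ hσ hn ht
  have h1 : (𝓕 (profile n σ δ₁ t) : L2 n) = MemLp.toLp (profileSymbol n σ δ₁ t) h := by
    rw [profile, dif_pos h]
    exact FourierTransform.fourier_fourierInv_eq _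
  rw [h1]
  exact MemLp.coeFn_toLp h

end

/-! Put `r = 2π|ξ|`, `a = r^(2δ₁)`, `b = r^(2σ)`. At each frequency the equation becomes `y'' + a y'
+ b y = 0`. As `2δ₁ < σ`, friction dominates near `r = 0`: the roots are real, the fast one close to
`-a`, the slow one close to `-b/a = -r^(2(σ-δ₁))`, and the slow mode has amplitude about `y₁/a`.
This is the symbol of the profile multiplied by the transform of `u₁`, whose value at zero frequency
is `P₁`.

To make this quantitative, the explicit solution is bounded pointwise
(`exists_rpow_mul_norm_dampedSol_le`). Where `8b ≤ a²` the root formulas give self-similar decay.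
Elsewhere a Lyapunov functional gives `exp(-t a/20)` with a polynomial loss in `r`, and the power of
`r` may be raised at will because `r` is bounded below there. Only bounded transformed data are
needed, which `u₀, u₁ ∈ L¹` provide; the exponential supplies all regularity for `t > 0`.

Substitute `ξ = t^(-κ) η` with `κ = 1/(2(σ-δ₁))`. The low-frequency bound becomes independent of
`t`, the high-frequency one is dominated for `t ≥ 1`, and `n > 4δ₁` makes the singularity
`r^(s-2δ₁)` square integrable. The rescaled solution converges pointwise to `P₁` times the profile
at time one (`tendsto_rpow_mul_solFamily_scaled`), and the profile itself is exactly self-similar.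
Dominated convergence then gives the limit of `t^(-rate)` times each norm: zero for the difference,
a positive number for the solution if `P₁ ≠ 0`.

A weak solution must also be shown to have the explicit Fourier transform
(`fourier_ae_eq_fourierSol`). On a ball of frequencies the multipliers are bounded operators, so the
weak equation integrates to a first order system in `L²`, and Grönwall's inequality identifies its
solution with the explicit one. -/

noncomputable section

/-! ### The characteristic equation and its explicit solution -/

/-- A complex square root of the discriminant `a² - 4b` of `λ² + aλ + b`. -/
def charDisc (a b : ℝ) : ℂ := ((a ^ 2 - 4 * b : ℝ) : ℂ) ^ ((2 : ℂ)⁻¹)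

/-- The root `(-a + √(a² - 4b)) / 2` of `λ² + aλ + b`. -/
def slowRoot (a b : ℝ) : ℂ := (-a + charDisc a b) / 2

/-- The root `(-a - √(a² - 4b)) / 2` of `λ² + aλ + b`. -/
def fastRoot (a b : ℝ) : ℂ := (-a - charDisc a b) / 2

/-- The `k`-th derivative at time `t` of the solution of `y'' + a y' + b y = 0`, `y(0) = y₀`,
`y'(0) = y₁`; the value is `0` in the case of a double root. -/
def dampedSol (a b : ℝ) (y₀ y₁ : ℂ) (k : ℕ) (t : ℝ) : ℂ :=
  ((y₁ - fastRoot a b * y₀) * (slowRoot a b ^ k * Complex.exp (slowRoot a b * t))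
    - (y₁ - slowRoot a b * y₀) * (fastRoot a b ^ k * Complex.exp (fastRoot a b * t)))
    / charDisc a b

theorem charDisc_sq (a b : ℝ) : charDisc a b ^ 2 = (a : ℂ) ^ 2 - 4 * b := by
  have h := Complex.cpow_nat_inv_pow ((a ^ 2 - 4 * b : ℝ) : ℂ) (n := 2) two_ne_zero
  rw [charDisc]
  push_cast at h ⊢
  exact h

theorem charDisc_ne_zero {a b : ℝ} (h : a ^ 2 ≠ 4 * b) : charDisc a b ≠ 0 := by
  intro h0
  have h1 := charDisc_sq a b
  rw [h0] at h1
  have h2 : ((a ^ 2 - 4 * b : ℝ) : ℂ) = 0 := by push_cast; rw [← h1]; norm_num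
  exact h (by have := Complex.ofReal_eq_zero.1 h2; linarith)

theorem slowRoot_eq_zero (a b : ℝ) : slowRoot a b ^ 2 = -a * slowRoot a b - b := by
  rw [slowRoot]
  linear_combination (1 / 4) * charDisc_sq a b

theorem fastRoot_eq_zero (a b : ℝ) : fastRoot a b ^ 2 = -a * fastRoot a b - b := by
  rw [fastRoot]
  linear_combination (1 / 4) * charDisc_sq a b

theorem dampedSol_zero_zero {a b : ℝ} (h : a ^ 2 ≠ 4 * b) (y₀ y₁ : ℂ) :
    dampedSol a b y₀ y₁ 0 0 = y₀ := by
  have := charDisc_ne_zero h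
  simp only [dampedSol, pow_zero, Complex.ofReal_zero, mul_zero, Complex.exp_zero, slowRoot,
    fastRoot]
  field_simp
  ring

theorem dampedSol_one_zero {a b : ℝ} (h : a ^ 2 ≠ 4 * b) (y₀ y₁ : ℂ) :
    dampedSol a b y₀ y₁ 1 0 = y₁ := by
  have := charDisc_ne_zero h
  simp only [dampedSol, pow_one, Complex.ofReal_zero, mul_zero, Complex.exp_zero, slowRoot,
    fastRoot]
  field_simp
  ring

/-- The formula divides by `charDisc a b = 0`. Frequencies with a double root form a null set, so
this value is harmless, and it lets the bounds hold at every frequency. -/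
theorem dampedSol_of_disc_eq {a b : ℝ} (h : a ^ 2 = 4 * b) (y₀ y₁ : ℂ) (k : ℕ) (t : ℝ) :
    dampedSol a b y₀ y₁ k t = 0 := by
  have h1 : charDisc a b = 0 := by
    have := charDisc_sq a b
    have h2 : (a : ℂ) ^ 2 - 4 * b = 0 := by
      have : ((a ^ 2 - 4 * b : ℝ) : ℂ) = 0 := by rw [h]; simp
      push_cast at this
      exact this
    rw [h2] at this
    exact pow_eq_zero_iff two_ne_zero |>.1 this
  simp [dampedSol, h1]

theorem dampedSol_add_two (a b : ℝ) (y₀ y₁ : ℂ) (k : ℕ) (t : ℝ) :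
    dampedSol a b y₀ y₁ (k + 2) t
      = -a * dampedSol a b y₀ y₁ (k + 1) t - b * dampedSol a b y₀ y₁ k t := by
  simp only [dampedSol, pow_add, slowRoot_eq_zero, fastRoot_eq_zero]
  ring

theorem hasDerivAt_dampedSol (a b : ℝ) (y₀ y₁ : ℂ) (k : ℕ) (t : ℝ) :
    HasDerivAt (dampedSol a b y₀ y₁ k) (dampedSol a b y₀ y₁ (k + 1) t) t := by
  have h (z : ℂ) : HasDerivAt (fun τ : ℝ => Complex.exp (z * τ)) (Complex.exp (z * t) * z) t := by
    have := ((hasDerivAt_id (t : ℂ)).const_mul z).cexp.comp_ofReal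
    simpa using this
  have h1 := ((((h (slowRoot a b)).const_mul (slowRoot a b ^ k)).const_mul
    (y₁ - fastRoot a b * y₀)).sub (((h (fastRoot a b)).const_mul (fastRoot a b ^ k)).const_mul
    (y₁ - slowRoot a b * y₀))).div_const (charDisc a b)
  refine h1.congr_deriv ?_
  rw [dampedSol]
  ring

/-! ### Energy decay and weak friction -/

/-- A Lyapunov functional for `y'' + a y' + b y = 0`, as a function of `(y, y')`. -/
def dampedEnergy (a b : ℝ) (y y' : ℂ) : ℝ :=
  ‖y'‖ ^ 2 / 2 + ‖y' + a * y‖ ^ 2 / 2 + b * ‖y‖ ^ 2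

/-- The equation gives `(y' + a y)' = -b y`, so the cross terms produced by the two squares cancel
against the derivative of `b ‖y‖²`, and only dissipation is left. -/
theorem hasDerivAt_dampedEnergy {a b : ℝ} {y y' : ℝ → ℂ} {t : ℝ}
    (h : HasDerivAt y (y' t) t) (h' : HasDerivAt y' (-a * y' t - b * y t) t) :
    HasDerivAt (fun τ => dampedEnergy a b (y τ) (y' τ))
      (-a * (‖y' t‖ ^ 2 + b * ‖y t‖ ^ 2)) t := by
  have e := ((h'.norm_sq.div_const 2).add ((h'.add (h.const_mul (a : ℂ))).norm_sq.div_const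
    2)).add (h.norm_sq.const_mul b)
  refine e.congr_deriv ?_
  simp only [Complex.inner, Complex.sq_norm, Complex.normSq_apply, Complex.mul_re, Complex.mul_im,
    Complex.conj_re, Complex.conj_im, Complex.add_re, Complex.add_im, Complex.sub_re,
    Complex.sub_im, Complex.neg_re, Complex.neg_im, Complex.ofReal_re, Complex.ofReal_im,
    Pi.add_apply]
  ring

/-- Bounds the energy by its dissipation, hence exponential decay at the rate `a b / (2 b + a²)`. -/
theorem dampedEnergy_upper {a b : ℝ} (hb : 0 < b) (y y' : ℂ) :
    b * dampedEnergy a b y y' ≤ (2 * b + a ^ 2) * (‖y'‖ ^ 2 + b * ‖y‖ ^ 2) := by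
  have h : ‖y' + a * y‖ ≤ ‖y'‖ + |a| * ‖y‖ := by
    refine (norm_add_le _ _).trans ?_
    rw [norm_mul, Complex.norm_real, Real.norm_eq_abs]
  have h2 : ‖y' + a * y‖ ^ 2 ≤ (‖y'‖ + |a| * ‖y‖) ^ 2 := by gcongr
  have h3 : ‖y' + a * y‖ ^ 2 ≤ 2 * ‖y'‖ ^ 2 + 2 * (a ^ 2 * ‖y‖ ^ 2) := by
    rw [← sq_abs a]
    nlinarith [sq_nonneg (‖y'‖ - |a| * ‖y‖)]
  have h4 : dampedEnergy a b y y' ≤ 2 * ‖y'‖ ^ 2 + (a ^ 2 + b) * ‖y‖ ^ 2 := by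
    rw [dampedEnergy]
    nlinarith [sq_nonneg ‖y'‖]
  have h5 := mul_le_mul_of_nonneg_left h4 hb.le
  have h6 : 0 ≤ b * b * ‖y‖ ^ 2 := by positivity
  have h7 : 0 ≤ a ^ 2 * ‖y'‖ ^ 2 := by positivity
  nlinarith

theorem dampedEnergy_le_exp {a b : ℝ} (ha : 0 < a) (hb : 0 < b) {y y' : ℝ → ℂ}
    (h : ∀ t, HasDerivAt y (y' t) t) (h' : ∀ t, HasDerivAt y' (-a * y' t - b * y t) t)
    {t : ℝ} (ht : 0 ≤ t) :
    dampedEnergy a b (y t) (y' t)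
      ≤ dampedEnergy a b (y 0) (y' 0) * Real.exp (-(a * b / (2 * b + a ^ 2)) * t) := by
  set θ := a * b / (2 * b + a ^ 2)
  have hd (τ : ℝ) : HasDerivAt (fun τ => dampedEnergy a b (y τ) (y' τ) * Real.exp (θ * τ))
      (-a * (‖y' τ‖ ^ 2 + b * ‖y τ‖ ^ 2) * Real.exp (θ * τ)
        + dampedEnergy a b (y τ) (y' τ) * (Real.exp (θ * τ) * θ)) τ := by
    refine (hasDerivAt_dampedEnergy (h τ) (h' τ)).mul ?_
    simpa using ((hasDerivAt_id τ).const_mul θ).exp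
  have hanti : Antitone (fun τ => dampedEnergy a b (y τ) (y' τ) * Real.exp (θ * τ)) := by
    refine antitone_of_deriv_nonpos (fun τ => (hd τ).differentiableAt) fun τ => ?_
    rw [(hd τ).deriv]
    have h1 : θ * dampedEnergy a b (y τ) (y' τ) ≤ a * (‖y' τ‖ ^ 2 + b * ‖y τ‖ ^ 2) := by
      have h0 : 0 < 2 * b + a ^ 2 := by positivity
      rw [show θ * dampedEnergy a b (y τ) (y' τ)
        = a * (b * dampedEnergy a b (y τ) (y' τ)) / (2 * b + a ^ 2) by simp only [θ]; ring,
        div_le_iff₀ h0]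
      nlinarith [mul_le_mul_of_nonneg_left (dampedEnergy_upper (a := a) hb (y τ) (y' τ)) ha.le]
    nlinarith [Real.exp_pos (θ * τ)]
  have h2 := hanti ht
  simp only [mul_zero, Real.exp_zero, mul_one] at h2
  rw [neg_mul, Real.exp_neg, ← div_eq_mul_inv, le_div_iff₀ (Real.exp_pos _)]
  exact h2

theorem dampedSol_energy_le {a b : ℝ} (ha : 0 < a) (hb : 0 < b) (y₀ y₁ : ℂ) {t : ℝ} (ht : 0 ≤ t) :
    dampedEnergy a b (dampedSol a b y₀ y₁ 0 t) (dampedSol a b y₀ y₁ 1 t)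
      ≤ (3 / 2 * ‖y₁‖ ^ 2 + (a ^ 2 + b) * ‖y₀‖ ^ 2)
        * Real.exp (-(a * b / (2 * b + a ^ 2)) * t) := by
  by_cases hd : a ^ 2 = 4 * b
  · simp only [dampedSol_of_disc_eq hd, dampedEnergy]
    simp only [norm_zero, mul_zero, add_zero]
    norm_num
    positivity
  · have h := dampedEnergy_le_exp ha hb (fun τ => hasDerivAt_dampedSol a b y₀ y₁ 0 τ)
      (fun τ => (hasDerivAt_dampedSol a b y₀ y₁ 1 τ).congr_deriv
        (dampedSol_add_two a b y₀ y₁ 0 τ)) ht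
    rw [dampedSol_zero_zero hd, dampedSol_one_zero hd] at h
    refine h.trans (mul_le_mul_of_nonneg_right ?_ (Real.exp_pos _).le)
    have h1 : ‖y₁ + a * y₀‖ ≤ ‖y₁‖ + a * ‖y₀‖ := by
      refine (norm_add_le _ _).trans ?_
      rw [norm_mul, Complex.norm_real, Real.norm_of_nonneg ha.le]
    have h2 : ‖y₁ + a * y₀‖ ^ 2 ≤ (‖y₁‖ + a * ‖y₀‖) ^ 2 := by gcongr
    rw [dampedEnergy]
    nlinarith [sq_nonneg (‖y₁‖ - a * ‖y₀‖)]

/-- Decay of the solutions at high frequencies, where the friction is weak. -/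
theorem norm_dampedSol_le_of_weak {a b M : ℝ} (ha : 0 < a) (hb : 0 < b) (hab : a ^ 2 ≤ 8 * b)
    {y₀ y₁ : ℂ} (h₀ : ‖y₀‖ ≤ M) (h₁ : ‖y₁‖ ≤ M) {t : ℝ} (ht : 0 ≤ t) (k : ℕ) :
    ‖dampedSol a b y₀ y₁ k t‖
      ≤ 5 * M * (9 * (1 + b + b⁻¹)) ^ (k + 1) * Real.exp (-(a * t / 20)) := by
  have hM : 0 ≤ M := (norm_nonneg _).trans h₀
  set Q := 1 + b + b⁻¹
  have hbi : 0 < b⁻¹ := by positivity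
  have hQ : 1 ≤ Q := by simp only [Q]; linarith
  have hE : dampedEnergy a b (dampedSol a b y₀ y₁ 0 t) (dampedSol a b y₀ y₁ 1 t)
      ≤ 11 * M ^ 2 * Q * Real.exp (-(a * t / 20)) ^ 2 := by
    refine (dampedSol_energy_le ha hb y₀ y₁ ht).trans ?_
    refine mul_le_mul ?_ ?_ (Real.exp_pos _).le (by positivity)
    · have e0 : ‖y₀‖ ^ 2 ≤ M ^ 2 := by gcongr
      have e1 : ‖y₁‖ ^ 2 ≤ M ^ 2 := by gcongr
      have e2 : (a ^ 2 + b) * ‖y₀‖ ^ 2 ≤ (9 * b) * M ^ 2 :=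
        mul_le_mul (by linarith) e0 (by positivity) (by positivity)
      simp only [Q]
      nlinarith [sq_nonneg M, mul_nonneg hb.le (sq_nonneg M), mul_nonneg hbi.le (sq_nonneg M)]
    · rw [← Real.exp_nat_mul]
      refine Real.exp_le_exp.2 ?_
      have h0 : 0 < 2 * b + a ^ 2 := by positivity
      -- Weak friction `a² ≤ 8b` makes the energy rate at least `a/10`; passing from the energy to
      -- norms halves it, whence the `20`.
      have : a / 10 ≤ a * b / (2 * b + a ^ 2) := by
        rw [div_le_div_iff₀ (by norm_num) h0]
        nlinarith
      push_cast
      nlinarith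
  set e := Real.exp (-(a * t / 20))
  have he : 0 < e := Real.exp_pos _
  have k1 : ‖dampedSol a b y₀ y₁ 1 t‖ ≤ 5 * M * Q * e := by
    refine abs_le_of_sq_le_sq' ?_ (by positivity) |>.2
    have : ‖dampedSol a b y₀ y₁ 1 t‖ ^ 2 ≤ 22 * M ^ 2 * Q * e ^ 2 := by
      rw [dampedEnergy] at hE
      nlinarith [sq_nonneg ‖dampedSol a b y₀ y₁ 1 t + a * dampedSol a b y₀ y₁ 0 t‖,
        mul_nonneg hb.le (sq_nonneg ‖dampedSol a b y₀ y₁ 0 t‖)]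
    nlinarith [mul_nonneg (mul_nonneg (sq_nonneg M) (sq_nonneg e)) (mul_nonneg (by linarith : 0 ≤ Q)
      (sub_nonneg.2 hQ)), mul_nonneg (mul_nonneg (sq_nonneg M) (sq_nonneg e))
      (by linarith : 0 ≤ Q)]
  have k0 : ‖dampedSol a b y₀ y₁ 0 t‖ ≤ 5 * M * Q * e := by
    refine abs_le_of_sq_le_sq' ?_ (by positivity) |>.2
    have h1 : b * ‖dampedSol a b y₀ y₁ 0 t‖ ^ 2 ≤ 11 * M ^ 2 * Q * e ^ 2 := by
      rw [dampedEnergy] at hE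
      nlinarith [sq_nonneg ‖dampedSol a b y₀ y₁ 1 t + a * dampedSol a b y₀ y₁ 0 t‖,
        sq_nonneg ‖dampedSol a b y₀ y₁ 1 t‖]
    have h2 : ‖dampedSol a b y₀ y₁ 0 t‖ ^ 2 ≤ 11 * M ^ 2 * Q * e ^ 2 * b⁻¹ := by
      rw [← div_eq_mul_inv, le_div_iff₀ hb]
      linarith
    have h3 : 11 * M ^ 2 * Q * e ^ 2 * b⁻¹ ≤ 11 * M ^ 2 * Q * e ^ 2 * Q := by
      gcongr
      simp only [Q]; linarith
    nlinarith [mul_nonneg (mul_nonneg (sq_nonneg M) (sq_nonneg e)) (sq_nonneg Q)]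
  have haQ : a ≤ 8 * Q := by
    simp only [Q]
    nlinarith [sq_nonneg (a - 1)]
  have hbQ : b ≤ Q := by simp only [Q]; linarith
  clear_value Q
  -- Higher derivatives follow from the equation itself: with `a ≤ 8Q` and `b ≤ Q` each one costs a
  -- factor `8Q + Q = 9Q`.
  induction k using Nat.twoStepInduction with
  | zero =>
    refine k0.trans ?_
    rw [zero_add, pow_one]
    have : 0 ≤ M * Q * e := by positivity
    nlinarith
  | one =>
    refine k1.trans ?_
    gcongr
    rw [one_add_one_eq_two]
    nlinarith
  | more k ih0 ih1 =>
    rw [dampedSol_add_two]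
    refine (norm_sub_le _ _).trans ?_
    rw [norm_mul, norm_mul, norm_neg, Complex.norm_real, Complex.norm_real,
      Real.norm_of_nonneg ha.le, Real.norm_of_nonneg hb.le]
    have i1 := mul_le_mul haQ ih1 (norm_nonneg _) (by positivity)
    have i0 := mul_le_mul hbQ ih0 (norm_nonneg _) (by positivity)
    refine (add_le_add i1 i0).trans ?_
    have hp : (9 * Q) ^ (k + 1) ≤ (9 * Q) ^ (k + 2) := pow_le_pow_right₀ (by linarith) (by omega)
    have : Q * (5 * M * (9 * Q) ^ (k + 1) * e) ≤ Q * (5 * M * (9 * Q) ^ (k + 2) * e) := by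
      gcongr Q * (5 * M * ?_ * e)
    calc _ ≤ 8 * Q * (5 * M * (9 * Q) ^ (k + 2) * e) + Q * (5 * M * (9 * Q) ^ (k + 2) * e) :=
          add_le_add_right this _
      _ = _ := by ring

/-! ### Strong friction, uniform bounds and the limit at low frequency -/

theorem charDisc_eq_sqrt {a b : ℝ} (h : 4 * b ≤ a ^ 2) :
    charDisc a b = (Real.sqrt (a ^ 2 - 4 * b) : ℝ) := by
  rw [charDisc, Real.sqrt_eq_rpow, Complex.ofReal_cpow (by linarith)]
  norm_num

/-- Half of the exponential pays for the power, by `x^k ≤ k! e^x`. The factors `4` and `2` match a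
root known only up to a factor two: `2x ≤ t·root ≤ 4x`. -/
theorem pow_mul_exp_neg_le (k : ℕ) {x : ℝ} (hx : 0 ≤ x) :
    (4 * x) ^ k * Real.exp (-(2 * x)) ≤ 4 ^ k * k.factorial * Real.exp (-x) := by
  have h := Real.pow_div_factorial_le_exp x hx k
  rw [div_le_iff₀ (by positivity)] at h
  have e : Real.exp (-(2 * x)) = Real.exp (-x) * Real.exp (-x) := by
    rw [← Real.exp_add]; ring_nf
  have e2 : Real.exp x * Real.exp (-x) = 1 := by rw [← Real.exp_add]; simp
  calc (4 * x) ^ k * Real.exp (-(2 * x)) = 4 ^ k * x ^ k * (Real.exp (-x) * Real.exp (-x)) := by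
        rw [e, mul_pow]
    _ ≤ 4 ^ k * (Real.exp x * k.factorial) * (Real.exp (-x) * Real.exp (-x)) := by gcongr
    _ = 4 ^ k * k.factorial * Real.exp (-x) * (Real.exp x * Real.exp (-x)) := by ring
    _ = _ := by rw [e2, mul_one]

/-- Decay of the solutions at low frequencies, where the friction dominates. -/
theorem pow_mul_norm_dampedSol_le_of_strong {a b : ℝ} (ha : 0 < a) (hb : 0 < b)
    (hab : 8 * b ≤ a ^ 2) (y₀ y₁ : ℂ) {t : ℝ} (ht : 0 ≤ t) (k : ℕ) :
    t ^ k * ‖dampedSol a b y₀ y₁ k t‖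
      ≤ 4 * 4 ^ k * k.factorial * ((‖y₁‖ + a * ‖y₀‖) / a) * Real.exp (-(t * b / (2 * a))) := by
  have hd := charDisc_eq_sqrt (a := a) (b := b) (by linarith)
  set d := Real.sqrt (a ^ 2 - 4 * b)
  have hd2 : d ^ 2 = a ^ 2 - 4 * b := Real.sq_sqrt (by linarith)
  have hd0 : 0 ≤ d := Real.sqrt_nonneg _
  have hda : a / 2 ≤ d := by nlinarith
  have hda' : d ≤ a := by nlinarith
  have hp : slowRoot a b = ((-((a - d) / 2) : ℝ) : ℂ) := by
    rw [slowRoot, hd]; push_cast; ring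
  have hm : fastRoot a b = ((-((a + d) / 2) : ℝ) : ℂ) := by
    rw [fastRoot, hd]; push_cast; ring
  -- The product of the roots is `b`, so `(a - d)/2 = 2b/(a + d)`, and `a/2 ≤ d ≤ a` places this
  -- between `b/a` and `2b/a`.
  have hlp : b / a ≤ (a - d) / 2 := by
    rw [div_le_div_iff₀ ha two_pos]; nlinarith
  have hlp' : (a - d) / 2 ≤ 2 * b / a := by
    rw [div_le_div_iff₀ two_pos ha]; nlinarith
  set p := (a - d) / 2
  set m := (a + d) / 2
  have hp0 : 0 ≤ p := by simp only [p]; linarith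
  have hm0 : 0 ≤ m := by simp only [m]; linarith
  have hma : m ≤ a := by simp only [m]; linarith
  have hma' : a / 2 ≤ m := by simp only [m]; linarith
  have hpa : p ≤ a := by simp only [p]; linarith
  have nexp (z : ℝ) (w : ℝ) : ‖((-z : ℝ) : ℂ) ^ k * Complex.exp (((-z : ℝ) : ℂ) * w)‖
      = |z| ^ k * Real.exp (-(z * w)) := by
    rw [norm_mul, norm_pow, Complex.norm_real, Real.norm_eq_abs, abs_neg, ← Complex.ofReal_mul,
      Complex.norm_exp_ofReal]
    ring_nf
  set S := ‖y₁‖ + a * ‖y₀‖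
  have hS : 0 ≤ S := by positivity
  have c1 (z : ℝ) (hz : 0 ≤ z) (hza : z ≤ a) : ‖y₁ - ((-z : ℝ) : ℂ) * y₀‖ ≤ S := by
    refine (norm_sub_le _ _).trans ?_
    rw [norm_mul, Complex.norm_real, Real.norm_eq_abs, abs_neg, abs_of_nonneg hz]
    simp only [S]
    gcongr
  set X := Real.exp (-(t * b / (2 * a)))
  have e1 : t ^ k * (p ^ k * Real.exp (-(p * t))) ≤ 4 ^ k * k.factorial * X := by
    refine le_trans ?_ (pow_mul_exp_neg_le k (x := t * b / (2 * a)) (by positivity))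
    rw [← mul_assoc, ← mul_pow]
    refine mul_le_mul ?_ ?_ (Real.exp_pos _).le (by positivity)
    · refine pow_le_pow_left₀ (by positivity) ?_ k
      calc t * p ≤ t * (2 * b / a) := by gcongr
        _ = _ := by field_simp; ring
    · refine Real.exp_le_exp.2 (neg_le_neg ?_)
      calc 2 * (t * b / (2 * a)) = b / a * t := by field_simp
        _ ≤ _ := by gcongr
  have e2 : t ^ k * (m ^ k * Real.exp (-(m * t))) ≤ 4 ^ k * k.factorial * X := by
    refine le_trans ?_ ((pow_mul_exp_neg_le k (x := t * a / 4) (by positivity)).trans ?_)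
    · rw [← mul_assoc, ← mul_pow]
      refine mul_le_mul ?_ ?_ (Real.exp_pos _).le (by positivity)
      · refine pow_le_pow_left₀ (by positivity) ?_ k
        calc t * m ≤ t * a := by gcongr
          _ = _ := by ring
      · refine Real.exp_le_exp.2 (neg_le_neg ?_)
        calc 2 * (t * a / 4) = a / 2 * t := by ring
          _ ≤ _ := by gcongr
    · gcongr
      refine Real.exp_le_exp.2 (neg_le_neg ?_)
      rw [div_le_div_iff₀ (by positivity) (by norm_num)]
      nlinarith [mul_le_mul_of_nonneg_left hab ht, mul_nonneg ht hb.le]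
  rw [dampedSol, norm_div, hp, hm, hd, Complex.norm_real, Real.norm_of_nonneg hd0]
  rw [← mul_div_assoc, div_le_iff₀ (by linarith)]
  calc _ ≤ t ^ k * (S * (p ^ k * Real.exp (-(p * t))) + S * (m ^ k * Real.exp (-(m * t)))) := by
        gcongr
        refine (norm_sub_le _ _).trans (add_le_add ?_ ?_)
        · rw [norm_mul, nexp, abs_of_nonneg hp0]
          exact mul_le_mul_of_nonneg_right (c1 m hm0 hma) (by positivity)
        · rw [norm_mul, nexp, abs_of_nonneg hm0]
          exact mul_le_mul_of_nonneg_right (c1 p hp0 hpa) (by positivity)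
    _ = S * (t ^ k * (p ^ k * Real.exp (-(p * t))) + t ^ k * (m ^ k * Real.exp (-(m * t)))) := by
        ring
    _ ≤ S * (4 ^ k * k.factorial * X + 4 ^ k * k.factorial * X) := by gcongr
    _ = 4 * 4 ^ k * k.factorial * (S / a) * X * (a / 2) := by field_simp; ring
    _ ≤ _ := by
        gcongr

/-- Bounds for the solutions that are uniform in time, at bounded frequencies. -/
theorem norm_dampedSol_bounded {a b A : ℝ} (ha : 0 < a) (hb : 0 < b) (haA : a ≤ A) (hbA : b ≤ A)
    (y₀ y₁ : ℂ) {t : ℝ} (ht : 0 ≤ t) :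
    ‖dampedSol a b y₀ y₁ 1 t‖ ≤ 2 * (1 + A) * (‖y₀‖ + ‖y₁‖) ∧
    b * ‖dampedSol a b y₀ y₁ 0 t‖ ≤ 2 * (1 + A) ^ 2 * (‖y₀‖ + ‖y₁‖) := by
  set S := ‖y₀‖ + ‖y₁‖
  have hA : 0 < A := ha.trans_le haA
  have hS : 0 ≤ S := by positivity
  have hE : dampedEnergy a b (dampedSol a b y₀ y₁ 0 t) (dampedSol a b y₀ y₁ 1 t)
      ≤ 2 * (1 + A) ^ 2 * S ^ 2 := by
    refine (dampedSol_energy_le ha hb y₀ y₁ ht).trans ?_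
    have h1 : Real.exp (-(a * b / (2 * b + a ^ 2)) * t) ≤ 1 := by
      rw [Real.exp_le_one_iff, neg_mul]
      exact neg_nonpos.2 (by positivity)
    refine (mul_le_of_le_one_right (by positivity) h1).trans ?_
    have h0 : ‖y₀‖ ^ 2 ≤ S ^ 2 := by gcongr; simp [S]
    have h1 : ‖y₁‖ ^ 2 ≤ S ^ 2 := by gcongr; simp [S]
    have h2 : (a ^ 2 + b) * ‖y₀‖ ^ 2 ≤ (A ^ 2 + A) * S ^ 2 := by gcongr
    nlinarith [sq_nonneg S, mul_nonneg hA.le (sq_nonneg S), mul_nonneg (sq_nonneg A) (sq_nonneg S)]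
  rw [dampedEnergy] at hE
  have p1 := sq_nonneg ‖dampedSol a b y₀ y₁ 1 t + a * dampedSol a b y₀ y₁ 0 t‖
  have p2 := mul_nonneg hb.le (sq_nonneg ‖dampedSol a b y₀ y₁ 0 t‖)
  have p3 := sq_nonneg ‖dampedSol a b y₀ y₁ 1 t‖
  constructor
  · refine abs_le_of_sq_le_sq' ?_ (by positivity) |>.2
    nlinarith
  · refine abs_le_of_sq_le_sq' ?_ (by positivity) |>.2
    have h1 : b * ‖dampedSol a b y₀ y₁ 0 t‖ ^ 2 ≤ 2 * (1 + A) ^ 2 * S ^ 2 := by linarith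
    have h2 : b * (b * ‖dampedSol a b y₀ y₁ 0 t‖ ^ 2) ≤ A * (2 * (1 + A) ^ 2 * S ^ 2) :=
      mul_le_mul hbA h1 p2 hA.le
    have h3 : 0 ≤ (1 + A) ^ 2 * S ^ 2 := by positivity
    calc _ = b * (b * ‖dampedSol a b y₀ y₁ 0 t‖ ^ 2) := by ring
      _ ≤ _ := h2
      _ ≤ (2 * (1 + A) ^ 2 * S) ^ 2 := by nlinarith [mul_nonneg h3 hA.le, mul_nonneg h3 (sq_nonneg A)]

/-- The energy controls `√b ‖y‖` only, which degenerates as `b → 0`. Integrating the bound on `y'`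
from the initial value avoids `b`, at the price of linear growth in time. -/
theorem norm_dampedSol_zero_le {a b A : ℝ} (ha : 0 < a) (hb : 0 < b) (haA : a ≤ A) (hbA : b ≤ A)
    (y₀ y₁ : ℂ) {t : ℝ} (ht : 0 ≤ t) :
    ‖dampedSol a b y₀ y₁ 0 t‖ ≤ (1 + 2 * (1 + A) * t) * (‖y₀‖ + ‖y₁‖) := by
  have hA : 0 < A := ha.trans_le haA
  by_cases hd : a ^ 2 = 4 * b
  · rw [dampedSol_of_disc_eq hd, norm_zero]
    positivity
  have h := (convex_Ici (0 : ℝ)).norm_image_sub_le_of_norm_hasDerivWithin_le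
    (fun τ _ => (hasDerivAt_dampedSol a b y₀ y₁ 0 τ).hasDerivWithinAt)
    (fun τ hτ => (norm_dampedSol_bounded ha hb haA hbA y₀ y₁ hτ).1) self_mem_Ici ht
  rw [dampedSol_zero_zero hd, sub_zero, Real.norm_of_nonneg ht] at h
  have h2 := norm_le_norm_add_norm_sub' (dampedSol a b y₀ y₁ 0 t) y₀
  nlinarith [norm_nonneg y₁]

/-- At low frequencies the solution is governed by the slow root. -/
theorem tendsto_dampedSol {ι : Type*} {l : Filter ι} {a b t : ι → ℝ} {y₀ y₁ : ι → ℂ} {c₀ c₁ : ℂ}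
    {τ : ℝ} (hapos : ∀ᶠ i in l, 0 < a i) (ha : Tendsto a l (𝓝 0))
    (hab : Tendsto (fun i => b i / a i ^ 2) l (𝓝 0))
    (hta : Tendsto (fun i => t i * a i) l atTop) (htb : ∀ᶠ i in l, t i * (b i / a i) = τ)
    (hy₀ : Tendsto y₀ l (𝓝 c₀)) (hy₁ : Tendsto y₁ l (𝓝 c₁)) (k : ℕ) :
    Tendsto (fun i => ((a i * t i ^ k : ℝ) : ℂ) * dampedSol (a i) (b i) (y₀ i) (y₁ i) k (t i)) l
      (𝓝 (c₁ * ((-τ) ^ k * Real.exp (-τ) : ℝ))) := by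
  -- Eventually `charDisc = a q`, and `lp`, `lm` below are the slow and the fast root.
  set q : ι → ℝ := fun i => Real.sqrt (1 - 4 * (b i / a i ^ 2))
  have hq : Tendsto q l (𝓝 1) := by
    have : Tendsto (fun i => 1 - 4 * (b i / a i ^ 2)) l (𝓝 1) := by
      simpa using (hab.const_mul 4).const_sub 1
    simpa using this.sqrt
  have hq0 (i : ι) : 0 ≤ q i := Real.sqrt_nonneg _
  set lp : ι → ℝ := fun i => -(a i * (1 - q i) / 2)
  set lm : ι → ℝ := fun i => -(a i * (1 + q i) / 2)
  have hlp : Tendsto lp l (𝓝 0) := by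
    have := ((ha.mul (hq.const_sub 1)).div_const 2).neg
    simpa using this
  have hlm : Tendsto lm l (𝓝 0) := by
    have := ((ha.mul (hq.const_add 1)).div_const 2).neg
    simpa using this
  have hev : ∀ᶠ i in l, 4 * (b i / a i ^ 2) ≤ 1 / 2 :=
    ((hab.const_mul 4).eventually_lt_const (by norm_num)).mono fun i hi => hi.le
  -- Rationalising, `lp = -2b / (a (1 + q))`, so `t · lp` is eventually `-2τ/(1 + q)`.
  have htlp : Tendsto (fun i => t i * lp i) l (𝓝 (-τ)) := by
    have : Tendsto (fun i => -(2 * τ / (1 + q i))) l (𝓝 (-(2 * τ / (1 + 1)))) :=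
      (tendsto_const_nhds.div (hq.const_add 1) (by norm_num)).neg
    rw [show -(2 * τ / (1 + 1)) = -τ by ring] at this
    refine this.congr' ?_
    filter_upwards [hev, htb, hapos] with i hi hti hai
    have h1 : q i ^ 2 = 1 - 4 * (b i / a i ^ 2) := Real.sq_sqrt (by linarith)
    have h2 : 0 < 1 + q i := by linarith [hq0 i]
    rw [← hti]
    simp only [lp]
    have h3 : b i = a i ^ 2 * (1 - q i ^ 2) / 4 := by rw [h1]; field_simp; ring
    rw [h3]
    field_simp
    ring
  have htlm : Tendsto (fun i => t i * lm i) l atBot := by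
    have h1 : Tendsto (fun i => (t i * a i) * ((1 + q i) / 2)) l atTop :=
      hta.atTop_mul_pos one_pos (by simpa using (hq.const_add 1).div_const 2)
    refine (tendsto_neg_atTop_atBot.comp h1).congr fun i => ?_
    simp only [lm, Function.comp]
    ring
  have hexp : Tendsto (fun i => (t i * lm i) ^ k * Real.exp (t i * lm i)) l (𝓝 0) := by
    have h1 := (Real.tendsto_pow_mul_exp_neg_atTop_nhds_zero k).comp
      (tendsto_neg_atBot_atTop.comp htlm)
    have h2 := (h1.const_mul ((-1) ^ k))
    rw [mul_zero] at h2
    refine h2.congr fun i => ?_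
    simp only [Function.comp, neg_neg]
    rw [← mul_assoc, ← mul_pow]
    ring_nf
  have hlpC : Tendsto (fun i => (lp i : ℂ)) l (𝓝 0) := by
    exact_mod_cast (Complex.continuous_ofReal.tendsto 0).comp hlp
  have hlmC : Tendsto (fun i => (lm i : ℂ)) l (𝓝 0) := by
    exact_mod_cast (Complex.continuous_ofReal.tendsto 0).comp hlm
  have hqC : Tendsto (fun i => (q i : ℂ)) l (𝓝 1) := by
    exact_mod_cast (Complex.continuous_ofReal.tendsto 1).comp hq
  have hP : Tendsto (fun i => (((t i * lp i) ^ k * Real.exp (t i * lp i) : ℝ) : ℂ)) l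
      (𝓝 (((-τ) ^ k * Real.exp (-τ) : ℝ) : ℂ)) :=
    (Complex.continuous_ofReal.tendsto _).comp ((htlp.pow k).mul htlp.rexp)
  have hN : Tendsto (fun i => (((t i * lm i) ^ k * Real.exp (t i * lm i) : ℝ) : ℂ)) l (𝓝 0) := by
    exact_mod_cast (Complex.continuous_ofReal.tendsto 0).comp hexp
  -- The prefactor `a` cancels against `charDisc = a q`, leaving the division by `q`; `t^k` joins
  -- the `k`-th power of each root.
  have hmain := (((hy₁.sub (hlmC.mul hy₀)).mul hP).sub ((hy₁.sub (hlpC.mul hy₀)).mul hN)).div hqC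
    one_ne_zero
  simp only [zero_mul, sub_zero, mul_zero, div_one] at hmain
  refine hmain.congr' ?_
  filter_upwards [hev, hapos] with i hi hai
  have h4 : 4 * b i ≤ a i ^ 2 := by
    have : 4 * b i / a i ^ 2 ≤ 1 := by rw [mul_div_assoc]; linarith
    rwa [div_le_one (by positivity)] at this
  have hd : charDisc (a i) (b i) = ((a i * q i : ℝ) : ℂ) := by
    rw [charDisc_eq_sqrt h4]
    congr 1
    simp only [q]
    rw [← Real.sqrt_sq hai.le, ← Real.sqrt_mul (sq_nonneg _), Real.sqrt_sq hai.le]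
    congr 1
    field_simp
  have hp : slowRoot (a i) (b i) = (lp i : ℂ) := by
    rw [slowRoot, hd]; simp only [lp]; push_cast; ring
  have hm : fastRoot (a i) (b i) = (lm i : ℂ) := by
    rw [fastRoot, hd]; simp only [lm]; push_cast; ring
  have haC : (a i : ℂ) ≠ 0 := by exact_mod_cast hai.ne'
  simp only [Pi.div_apply]
  rw [dampedSol, hd, hp, hm, Complex.ofReal_mul (a i) (q i), mul_div_assoc',
    Complex.ofReal_mul (a i) (t i ^ k),
    mul_assoc (a i : ℂ), mul_div_mul_left _ _ haC]
  congr 1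
  push_cast
  rw [mul_comm (lp i : ℂ) (t i : ℂ), mul_comm (lm i : ℂ) (t i : ℂ)]
  ring

/-! ### Square integrability and pointwise decay in frequency -/

theorem memLp_rpow_mul_exp_neg {n : ℕ} {α c q : ℝ} (hn : 0 < n) (hα : 0 < n + 2 * α) (hc : 0 < c)
    (hq : 0 < q) :
    MemLp (fun ξ : EuclideanSpace ℝ (Fin n) =>
      (2 * Real.pi * ‖ξ‖) ^ α * Real.exp (-(c * (2 * Real.pi * ‖ξ‖) ^ q))) 2 volume := by
  have hpi := Real.pi_pos
  have : Nonempty (Fin n) := ⟨⟨0, hn⟩⟩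
  have hm (β : ℝ) : Measurable fun ξ : EuclideanSpace ℝ (Fin n) => (2 * Real.pi * ‖ξ‖) ^ β :=
    (measurable_norm.const_mul _).pow_const β
  have hmeas : AEStronglyMeasurable (fun ξ : EuclideanSpace ℝ (Fin n) =>
      (2 * Real.pi * ‖ξ‖) ^ α * Real.exp (-(c * (2 * Real.pi * ‖ξ‖) ^ q))) volume :=
    ((hm α).mul (Real.measurable_exp.comp ((hm q).const_mul c).neg)).aestronglyMeasurable
  rw [memLp_two_iff_integrable_sq hmeas, integrable_fun_norm_addHaar volume (f := fun r : ℝ =>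
    ((2 * Real.pi * r) ^ α * Real.exp (-(c * (2 * Real.pi * r) ^ q))) ^ 2)]
  -- In polar coordinates the power at the origin is `r^(n-1+2α)`, integrable because `n + 2α > 0`.
  have hbase := (integrableOn_rpow_mul_exp_neg_mul_rpow (p := q)
    (s := (n : ℝ) - 1 + 2 * α) (b := 2 * c * (2 * Real.pi) ^ q)
    (by linarith) hq (by positivity)).const_mul ((2 * Real.pi) ^ (2 * α))
  refine (integrableOn_congr_fun ?_ measurableSet_Ioi).1 hbase
  intro r hr
  have hr : 0 < r := hr
  simp only [finrank_euclideanSpace, Fintype.card_fin, smul_eq_mul]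
  rw [mul_pow, ← Real.exp_nat_mul, ← Real.rpow_mul_natCast (by positivity),
    Real.mul_rpow (by positivity) hr.le, Real.mul_rpow (by positivity) hr.le,
    Real.rpow_add hr, ← Real.rpow_natCast, Nat.cast_sub (by omega)]
  have e : α * ((2 : ℕ) : ℝ) = 2 * α := by push_cast; ring
  have e2 : ((2 : ℕ) : ℝ) * (-(c * ((2 * Real.pi) ^ q * r ^ q)))
      = -(2 * c * (2 * Real.pi) ^ q) * r ^ q := by push_cast; ring
  rw [e, e2]
  push_cast
  ring

/-- Pointwise decay of the solution of the transformed equation. The first summand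
on the right-hand side accounts for the low frequencies, the second one for the high ones. -/
theorem exists_rpow_mul_norm_dampedSol_le {σ δ s N : ℝ} (hδ : 0 < δ) (hδσ : δ < σ / 2)
    (k : ℕ) (hN : 2 * σ * (k + 1) + s ≤ N) :
    ∃ C, 0 ≤ C ∧ ∀ (M : ℝ) (y₀ y₁ : ℂ), ‖y₀‖ ≤ M → ‖y₁‖ ≤ M → ∀ r t : ℝ, 0 < r → 0 < t →
      r ^ s * ‖dampedSol (r ^ (2 * δ)) (r ^ (2 * σ)) y₀ y₁ k t‖
        ≤ C * M * ((t ^ k)⁻¹ * (r ^ (s - 2 * δ) * Real.exp (-(t / 2 * r ^ (2 * (σ - δ)))))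
          + r ^ N * Real.exp (-(t / 20 * r ^ (2 * δ)))) := by
  -- The frequency at which `8b = a²`, since `b = a² r^(2σ-4δ)`; it separates the two regimes.
  set ε : ℝ := (1 / 8) ^ (1 / (2 * σ - 4 * δ))
  have hε : 0 < ε := by positivity
  set B := ε ^ (2 * σ)
  have hB : 0 < B := by positivity
  -- For `b ≥ B` one has `1 + b + b⁻¹ ≤ D b`, which turns the high-frequency loss into a pure power
  -- of `r`.
  set D := B⁻¹ + 1 + (B ^ 2)⁻¹
  have hD : 0 < D := by positivity
  set N₀ := 2 * σ * (k + 1) + s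
  set C₁ : ℝ := 4 * 4 ^ k * k.factorial * 2
  set C₂ : ℝ := 5 * (9 * D) ^ (k + 1) * ε ^ (-(N - N₀))
  have hC₁ : 0 ≤ C₁ := by positivity
  have hC₂ : 0 ≤ C₂ := by positivity
  refine ⟨C₁ + C₂, by positivity, fun M y₀ y₁ h₀ h₁ r t hr ht => ?_⟩
  have hM : 0 ≤ M := (norm_nonneg _).trans h₀
  set a := r ^ (2 * δ)
  set b := r ^ (2 * σ)
  have ha : 0 < a := by positivity
  have hb : 0 < b := by positivity
  have ha2 : a ^ 2 = r ^ (4 * δ) := by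
    rw [← Real.rpow_mul_natCast hr.le]; congr 1; push_cast; ring
  have hba2 : b = a ^ 2 * r ^ (2 * σ - 4 * δ) := by
    rw [ha2, ← Real.rpow_add hr, add_sub_cancel]
  have hba : b / a = r ^ (2 * (σ - δ)) := by
    rw [← Real.rpow_sub hr]; congr 1; ring
  set X := (t ^ k)⁻¹ * (r ^ (s - 2 * δ) * Real.exp (-(t / 2 * r ^ (2 * (σ - δ)))))
  set Z := r ^ N * Real.exp (-(t / 20 * a))
  have hX : 0 ≤ X := by positivity
  have hZ : 0 ≤ Z := by positivity
  rcases le_total (8 * b) (a ^ 2) with hab | hab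
  · have hr1 : r ≤ 1 := by
      by_contra! hr1
      have : 1 ≤ r ^ (2 * σ - 4 * δ) := Real.one_le_rpow hr1.le (by linarith)
      nlinarith [mul_le_mul_of_nonneg_left this (sq_nonneg a), sq_pos_of_pos ha]
    have ha1 : a ≤ 1 := Real.rpow_le_one hr.le hr1 (by linarith)
    have h := pow_mul_norm_dampedSol_le_of_strong ha hb hab y₀ y₁ ht.le k
    have hS : (‖y₁‖ + a * ‖y₀‖) / a ≤ 2 * M / a := by
      gcongr
      nlinarith [norm_nonneg y₀]
    have h2 : ‖dampedSol a b y₀ y₁ k t‖ ≤ (t ^ k)⁻¹ * (C₁ * (M / a)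
        * Real.exp (-(t * b / (2 * a)))) := by
      rw [inv_mul_eq_div, le_div_iff₀ (by positivity), mul_comm]
      refine h.trans ?_
      calc _ ≤ 4 * 4 ^ k * k.factorial * (2 * M / a) * Real.exp (-(t * b / (2 * a))) := by gcongr
        _ = _ := by simp only [C₁]; ring
    calc _ ≤ r ^ s * ((t ^ k)⁻¹ * (C₁ * (M / a) * Real.exp (-(t * b / (2 * a))))) := by gcongr
      _ = C₁ * M * X := by
        simp only [X]
        rw [Real.rpow_sub hr, ← hba, show t / 2 * (b / a) = t * b / (2 * a) by field_simp]
        simp only [a]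
        ring
      _ ≤ (C₁ + C₂) * M * (X + Z) := by
        gcongr <;> linarith
  · have hrε : ε ≤ r := by
      have h1 : 1 / 8 ≤ r ^ (2 * σ - 4 * δ) := by
        by_contra! h1
        nlinarith [mul_lt_mul_of_pos_left h1 (sq_pos_of_pos ha)]
      have h2 := Real.rpow_le_rpow (by norm_num) h1
        (z := 1 / (2 * σ - 4 * δ)) (by apply one_div_nonneg.2; linarith)
      rwa [← Real.rpow_mul hr.le, mul_one_div_cancel (by linarith), Real.rpow_one] at h2
    have hBb : B ≤ b := Real.rpow_le_rpow hε.le hrε (by linarith)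
    have hQ : 1 + b + b⁻¹ ≤ D * b := by
      have h1 : 1 ≤ B⁻¹ * b := by rw [inv_mul_eq_div, le_div_iff₀ hB]; linarith
      have h2 : b⁻¹ ≤ (B ^ 2)⁻¹ * b := by
        rw [inv_mul_eq_div, le_div_iff₀ (by positivity), inv_mul_le_iff₀ hb]
        nlinarith
      simp only [D]
      nlinarith
    have h := norm_dampedSol_le_of_weak ha hb hab h₀ h₁ ht.le k
    -- Since `ε ≤ r`, the exponent may be raised from `N₀` to any larger `N` at the cost of a
    -- constant.
    have hrN : r ^ N₀ ≤ ε ^ (-(N - N₀)) * r ^ N := by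
      rw [Real.rpow_neg hε.le, inv_mul_eq_div, le_div_iff₀ (by positivity)]
      calc r ^ N₀ * ε ^ (N - N₀) ≤ r ^ N₀ * r ^ (N - N₀) := by
            gcongr
        _ = r ^ N := by rw [← Real.rpow_add hr]; congr 1; ring
    calc _ ≤ r ^ s * (5 * M * (9 * (1 + b + b⁻¹)) ^ (k + 1) * Real.exp (-(a * t / 20))) := by
          gcongr
      _ ≤ r ^ s * (5 * M * (9 * (D * b)) ^ (k + 1) * Real.exp (-(a * t / 20))) := by gcongr
      _ = 5 * M * (9 * D) ^ (k + 1) * Real.exp (-(t / 20 * a)) * r ^ N₀ := by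
        have : b ^ (k + 1) * r ^ s = r ^ N₀ := by
          simp only [b]
          rw [← Real.rpow_mul_natCast hr.le, ← Real.rpow_add hr]
          congr 1
          push_cast
          ring
        rw [← this, ← mul_assoc 9, mul_pow (9 * D), show a * t / 20 = t / 20 * a by ring]
        ring
      _ ≤ 5 * M * (9 * D) ^ (k + 1) * Real.exp (-(t / 20 * a)) * (ε ^ (-(N - N₀)) * r ^ N) := by
        gcongr
      _ = C₂ * M * Z := by simp only [C₂, Z]; ring
      _ ≤ (C₁ + C₂) * M * (X + Z) := by
        gcongr <;> linarith

/-! ### Differentiation and scaling in `L²` -/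

section LpDeriv

variable {α : Type*} [MeasurableSpace α] {μ : Measure α}

/-- A family of `L²` functions with pointwise time derivatives is differentiable in `L²`
if the second derivatives are dominated. -/
theorem Lp_hasDerivWithinAt_of_dominated {S : Set ℝ} (hS : Convex ℝ S) {f g : ℝ → Lp ℂ 2 μ}
    {Φ₀ Φ₁ Φ₂ : ℝ → α → ℂ} {b : α → ℝ} (hb : MemLp b 2 μ)
    (hf : ∀ t ∈ S, f t =ᵐ[μ] Φ₀ t) (hg : ∀ t ∈ S, g t =ᵐ[μ] Φ₁ t)
    (h₀ : ∀ x, ∀ t ∈ S, HasDerivWithinAt (fun τ => Φ₀ τ x) (Φ₁ t x) S t)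
    (h₁ : ∀ x, ∀ t ∈ S, HasDerivWithinAt (fun τ => Φ₁ τ x) (Φ₂ t x) S t)
    (hbd : ∀ x, ∀ t ∈ S, ‖Φ₂ t x‖ ≤ b x) {t : ℝ} (ht : t ∈ S) :
    HasDerivWithinAt f (g t) S t := by
  -- Taylor's bound at fixed `x`, from two applications of the mean value inequality; its `L²` norm
  -- is then `O((τ - t)²)`.
  have hpt (x : α) (τ : ℝ) (hτ : τ ∈ S) :
      ‖Φ₀ τ x - Φ₀ t x - (τ - t) • Φ₁ t x‖ ≤ (τ - t) ^ 2 * b x := by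
    set I := uIcc t τ
    have hI : I ⊆ S := hS.ordConnected.uIcc_subset ht hτ
    have hd (ρ : ℝ) (hρ : ρ ∈ I) : HasDerivWithinAt (fun ρ => Φ₀ ρ x - ρ • Φ₁ t x)
        (Φ₁ ρ x - Φ₁ t x) I ρ := by
      have := (hasDerivWithinAt_id ρ I).smul_const (Φ₁ t x)
      rw [one_smul] at this
      exact ((h₀ x ρ (hI hρ)).mono hI).sub this
    have hbI (ρ : ℝ) (hρ : ρ ∈ I) : ‖Φ₁ ρ x - Φ₁ t x‖ ≤ |τ - t| * b x := by
      have h := hS.norm_image_sub_le_of_norm_hasDerivWithin_le (h₁ x) (hbd x) ht (hI hρ)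
      have hb0 : 0 ≤ b x := (norm_nonneg _).trans (hbd x t ht)
      rw [Real.norm_eq_abs] at h
      have := abs_sub_left_of_mem_uIcc hρ
      nlinarith
    have h := (convex_uIcc t τ).norm_image_sub_le_of_norm_hasDerivWithin_le hd hbI
      left_mem_uIcc right_mem_uIcc
    rw [Real.norm_eq_abs] at h
    calc _ = ‖Φ₀ τ x - τ • Φ₁ t x - (Φ₀ t x - t • Φ₁ t x)‖ := by rw [sub_smul]; congr 1; abel
      _ ≤ _ := h
      _ = _ := by rw [← sq_abs (τ - t)]; ring
  set B := ‖hb.toLp b‖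
  have hn (τ : ℝ) (hτ : τ ∈ S) : ‖f τ - f t - (τ - t) • g t‖ ≤ (τ - t) ^ 2 * B := by
    refine Lp.norm_le_mul_norm_of_ae_le_mul ?_
    filter_upwards [hf τ hτ, hf t ht, hg t ht, Lp.coeFn_sub (f τ - f t) ((τ - t) • g t),
      Lp.coeFn_sub (f τ) (f t), Lp.coeFn_smul (τ - t) (g t), hb.coeFn_toLp] with x e1 e2 e3 e4 e5 e6 e7
    rw [e4, Pi.sub_apply, e5, Pi.sub_apply, e6, Pi.smul_apply, e1, e2, e3, e7]
    refine (hpt x τ hτ).trans ?_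
    gcongr
    exact le_abs_self _
  rw [hasDerivWithinAt_iff_isLittleO]
  have hO : (fun τ => f τ - f t - (τ - t) • g t) =O[𝓝[S] t] fun τ => (τ - t) ^ 2 := by
    refine Asymptotics.IsBigO.of_bound B ?_
    filter_upwards [self_mem_nhdsWithin] with τ hτ
    rw [Real.norm_of_nonneg (sq_nonneg _), mul_comm]
    exact hn τ hτ
  refine hO.trans_isLittleO ?_
  have : (fun τ : ℝ => (τ - t) ^ 2) =o[𝓝 t] fun τ => τ - t := by
    have h := (Asymptotics.isLittleO_pow_id (𝕜 := ℝ) one_lt_two).comp_tendsto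
      (k := fun τ : ℝ => τ - t) (l' := 𝓝 t) (by
        have : Tendsto (fun τ : ℝ => τ - t) (𝓝 t) (𝓝 (t - t)) := tendsto_id.sub_const t
        rwa [sub_self] at this)
    exact h
  exact this.mono nhdsWithin_le_nhds

theorem contDiffOn_of_hasDerivAt_family {X : Type*} [NormedAddCommGroup X] [NormedSpace ℝ X]
    {S : Set ℝ} (hS : IsOpen S) {F : ℕ → ℝ → X}
    (hF : ∀ k, ∀ t ∈ S, HasDerivAt (F k) (F (k + 1) t) t) (m k : ℕ) :
    ContDiffOn ℝ m (F k) S := by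
  induction m generalizing k with
  | zero =>
    exact contDiffOn_zero.2 fun t ht => (hF k t ht).continuousAt.continuousWithinAt
  | succ m ih =>
    push_cast
    rw [contDiffOn_succ_iff_deriv_of_isOpen hS]
    refine ⟨fun t ht => (hF k t ht).differentiableAt.differentiableWithinAt, by simp, ?_⟩
    exact (ih (k + 1)).congr fun t ht => (hF k t ht).deriv

theorem iteratedDeriv_of_hasDerivAt_family {X : Type*} [NormedAddCommGroup X] [NormedSpace ℝ X]
    {S : Set ℝ} (hS : IsOpen S) {F : ℕ → ℝ → X}
    (hF : ∀ k, ∀ t ∈ S, HasDerivAt (F k) (F (k + 1) t) t) (k : ℕ) {t : ℝ} (ht : t ∈ S) :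
    iteratedDeriv k (F 0) t = F k t := by
  induction k generalizing t with
  | zero => simp
  | succ k ih =>
    rw [iteratedDeriv_succ]
    have : iteratedDeriv k (F 0) =ᶠ[𝓝 t] F k := by
      filter_upwards [hS.mem_nhds ht] with τ hτ using ih hτ
    rw [this.deriv_eq, (hF k t ht).deriv]

/-- Smoothness in time of a function whose image under an isometry is given by a dominated family
of pointwise derivatives. -/
theorem contDiffOn_and_iteratedDeriv_of_dominated {X : Type*} [NormedAddCommGroup X]
    [NormedSpace ℂ X] (L : X ≃ₗᵢ[ℂ] Lp ℂ 2 μ) {Φ : ℕ → ℝ → α → ℂ}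
    (hΦ : ∀ k x t, 0 < t → HasDerivAt (fun τ => Φ k τ x) (Φ (k + 1) t x) t)
    (hmeas : ∀ k t, 0 < t → AEStronglyMeasurable (Φ k t) μ)
    (hbd : ∀ k, ∀ t₀ > 0, ∃ b : α → ℝ, MemLp b 2 μ ∧ ∀ t > t₀, ∀ x, ‖Φ k t x‖ ≤ b x)
    {f : ℝ → X} (hf : ∀ t > 0, L (f t) =ᵐ[μ] Φ 0 t) (k : ℕ) :
    ContDiffOn ℝ k f (Ioi 0) ∧ ∀ t > 0, L (iteratedDeriv k f t) =ᵐ[μ] Φ k t := by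
  have hmem (k : ℕ) (t : ℝ) (ht : 0 < t) : MemLp (Φ k t) 2 μ := by
    obtain ⟨b, hb, hb'⟩ := hbd k (t / 2) (by positivity)
    refine hb.mono' (hmeas k t ht) (ae_of_all _ fun x => hb' t (by linarith) x)
  classical
  set G : ℕ → ℝ → Lp ℂ 2 μ := fun k t => if h : 0 < t then (hmem k t h).toLp _ else 0
  have hG (k : ℕ) (t : ℝ) (ht : 0 < t) : G k t =ᵐ[μ] Φ k t := by
    simp only [G, dif_pos ht]
    exact MemLp.coeFn_toLp _
  have hGd (k : ℕ) (t : ℝ) (ht : t ∈ Ioi (0 : ℝ)) : HasDerivAt (G k) (G (k + 1) t) t := by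
    have ht : 0 < t := ht
    obtain ⟨b, hb, hb'⟩ := hbd (k + 2) (t / 2) (by positivity)
    have hpos (τ : ℝ) (hτ : τ ∈ Ioi (t / 2)) : 0 < τ := lt_trans (by positivity) hτ
    exact (Lp_hasDerivWithinAt_of_dominated (convex_Ioi (t / 2)) hb
      (fun τ hτ => hG k τ (hpos τ hτ)) (fun τ hτ => hG (k + 1) τ (hpos τ hτ))
      (fun x τ hτ => (hΦ k x τ (hpos τ hτ)).hasDerivWithinAt)
      (fun x τ hτ => (hΦ (k + 1) x τ (hpos τ hτ)).hasDerivWithinAt)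
      (fun x τ hτ => hb' τ hτ x) (by rw [mem_Ioi]; linarith)).hasDerivAt
      (Ioi_mem_nhds (by linarith))
  set F : ℕ → ℝ → X := fun k t => L.symm (G k t)
  have hFd (k : ℕ) (t : ℝ) (ht : t ∈ Ioi (0 : ℝ)) : HasDerivAt (F k) (F (k + 1) t) t :=
    ((L.symm.toContinuousLinearEquiv.toContinuousLinearMap.restrictScalars
      ℝ).hasFDerivAt.comp_hasDerivAt t (hGd k t ht))
  have hfF : EqOn f (F 0) (Ioi 0) := fun t ht => by
    simp only [F]
    rw [← L.symm_apply_apply (f t)]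
    congr 1
    exact Lp.ext ((hf t ht).trans (hG 0 t ht).symm)
  refine ⟨(contDiffOn_of_hasDerivAt_family isOpen_Ioi hFd k 0).congr hfF, fun t ht => ?_⟩
  have h1 : iteratedDeriv k f t = iteratedDeriv k (F 0) t :=
    Filter.EventuallyEq.iteratedDeriv_eq k (hfF.eventuallyEq_of_mem (Ioi_mem_nhds ht))
  rw [h1, iteratedDeriv_of_hasDerivAt_family isOpen_Ioi hFd k ht]
  simp only [F, L.apply_symm_apply]
  exact hG k t ht

theorem Lp_norm_sq_eq_integral {f : Lp ℂ 2 μ} {F : α → ℂ} (h : f =ᵐ[μ] F) :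
    ‖f‖ ^ 2 = ∫ x, ‖F x‖ ^ 2 ∂μ := by
  have h1 := L2.inner_def (𝕜 := ℂ) f f
  have h2 : inner ℂ f f = ((‖f‖ ^ 2 : ℝ) : ℂ) := by
    rw [inner_self_eq_norm_sq_to_K]; norm_cast
  have h3 : (∫ x, inner ℂ (f x) (f x) ∂μ) = ((∫ x, ‖F x‖ ^ 2 ∂μ : ℝ) : ℂ) := by
    rw [← integral_complex_ofReal]
    refine integral_congr_ae ?_
    filter_upwards [h] with x hx
    rw [inner_self_eq_norm_sq_to_K, hx]
    norm_cast
  rw [h2, h3] at h1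
  exact_mod_cast h1

end LpDeriv

/-- Dominated convergence in self-similar variables. -/
theorem tendsto_rpow_mul_norm_sq_of_scaling {n : ℕ} {κ l : ℝ} {ψ : ℝ → L2 n}
    {Ψ : ℝ → EuclideanSpace ℝ (Fin n) → ℂ} {Ψ' : EuclideanSpace ℝ (Fin n) → ℂ}
    {H : EuclideanSpace ℝ (Fin n) → ℝ} (hH : MemLp H 2 volume)
    (hmeas : ∀ t > 0, Measurable (Ψ t)) (hψ : ∀ t > 0, ψ t =ᵐ[volume] Ψ t)
    (hbd : ∀ t ≥ 1, ∀ η, t ^ l * ‖Ψ t (t ^ (-κ) • η)‖ ≤ H η)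
    (hlim : ∀ᵐ η, Tendsto (fun t : ℝ => t ^ l * ‖Ψ t (t ^ (-κ) • η)‖) atTop (𝓝 ‖Ψ' η‖)) :
    Tendsto (fun t : ℝ => (t ^ (l + κ * n / 2) * ‖ψ t‖) ^ 2) atTop (𝓝 (∫ η, ‖Ψ' η‖ ^ 2)) := by
  have hconv : Tendsto (fun t : ℝ => ∫ η, (t ^ l * ‖Ψ t (t ^ (-κ) • η)‖) ^ 2) atTop
      (𝓝 (∫ η, ‖Ψ' η‖ ^ 2)) := by
    refine tendsto_integral_filter_of_dominated_convergence (fun η => H η ^ 2) ?_ ?_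
      hH.integrable_sq ?_
    · filter_upwards [eventually_gt_atTop 0] with t ht
      have := (hmeas t ht).comp (measurable_const_smul (t ^ (-κ)))
      exact ((this.norm.const_mul (t ^ l)).pow_const 2).aestronglyMeasurable
    · filter_upwards [eventually_ge_atTop 1] with t ht
      refine ae_of_all _ fun η => ?_
      rw [Real.norm_of_nonneg (sq_nonneg _)]
      have : 0 ≤ t := by linarith
      gcongr
      exact hbd t ht η
    · filter_upwards [hlim] with η hη using hη.pow 2
  refine hconv.congr' ?_
  filter_upwards [eventually_gt_atTop 0] with t ht
  simp only [mul_pow]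
  -- The Jacobian of the dilation is `t^(κn)`, which contributes `κn/2` to the exponent of the norm.
  rw [integral_const_mul, Measure.integral_comp_smul volume (fun ξ => ‖Ψ t ξ‖ ^ 2) (t ^ (-κ)),
    ← Lp_norm_sq_eq_integral (hψ t ht), finrank_euclideanSpace, Fintype.card_fin,
    abs_of_nonneg (by positivity), smul_eq_mul, ← mul_assoc]
  congr 1
  rw [← Real.rpow_mul_natCast ht.le, ← Real.rpow_mul_natCast ht.le, ← Real.rpow_mul_natCast ht.le,
    ← Real.rpow_neg ht.le, ← Real.rpow_add ht]
  congr 1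
  push_cast
  ring

/-! ### Weak solutions and uniqueness for bounded operators -/

section Abstract

variable {X : Type*} [NormedAddCommGroup X]

theorem eq_of_hasDerivWithinAt_Ici_eq [NormedSpace ℝ X] {f g f' : ℝ → X}
    (hf : ∀ t, 0 ≤ t → HasDerivWithinAt f (f' t) (Ici 0) t)
    (hg : ∀ t, 0 ≤ t → HasDerivWithinAt g (f' t) (Ici 0) t) (h0 : f 0 = g 0) {t : ℝ} (ht : 0 ≤ t) :
    f t = g t := by
  have h := (convex_Ici (0 : ℝ)).norm_image_sub_le_of_norm_hasDerivWithin_le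
    (f := fun t => f t - g t) (f' := fun t => f' t - f' t) (C := 0)
    (fun τ hτ => (hf τ hτ).sub (hg τ hτ)) (fun τ _ => by simp) self_mem_Ici ht
  simpa [h0, sub_eq_zero] using h

/-- A linear first order system with bounded coefficients has only the trivial solution with
vanishing initial data. -/
theorem eq_zero_of_damped_system [NormedSpace ℂ X] (A B : X →L[ℂ] X) {w z : ℝ → X}
    (hw : ∀ t, 0 ≤ t → HasDerivWithinAt w (z t - A (w t)) (Ici 0) t)
    (hz : ∀ t, 0 ≤ t → HasDerivWithinAt z (-B (w t)) (Ici 0) t) (hw0 : w 0 = 0) (hz0 : z 0 = 0)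
    {t : ℝ} (ht : 0 ≤ t) : w t = 0 := by
  -- `z` plays the role of `w' + A w`. In phase space with the maximum norm the vector field is
  -- bounded by `1 + ‖A‖ + ‖B‖` times the state.
  set f : ℝ → X × X := fun t => (w t, z t)
  have hd (τ : ℝ) (hτ : 0 ≤ τ) :
      HasDerivWithinAt f (z τ - A (w τ), -B (w τ)) (Ici 0) τ := (hw τ hτ).prodMk (hz τ hτ)
  have h := norm_le_gronwallBound_of_norm_deriv_right_le (f := f)
    (f' := fun τ => (z τ - A (w τ), -B (w τ))) (δ := 0) (K := 1 + ‖A‖ + ‖B‖) (ε := 0) (a := 0)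
    (b := t) (fun τ hτ => ((hd τ hτ.1).continuousWithinAt).mono Icc_subset_Ici_self)
    (fun τ hτ => (hd τ hτ.1).mono (Ici_subset_Ici.2 hτ.1)) (by simp [f, hw0, hz0]) ?_ t
    ⟨ht, le_rfl⟩
  · rw [gronwallBound_ε0_δ0] at h
    have := norm_le_zero_iff.1 h
    exact congrArg Prod.fst this
  · intro τ _
    have h1 : ‖w τ‖ ≤ ‖f τ‖ := norm_fst_le (f τ)
    have h2 : ‖z τ‖ ≤ ‖f τ‖ := norm_snd_le (f τ)
    have h3 := A.le_opNorm (w τ)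
    have h4 := B.le_opNorm (w τ)
    have h5 := mul_le_mul_of_nonneg_left h1 (norm_nonneg A)
    have h6 := mul_le_mul_of_nonneg_left h1 (norm_nonneg B)
    have h7 := norm_nonneg (f τ)
    rw [add_zero]
    refine max_le ?_ ?_
    · refine (norm_sub_le _ _).trans ?_
      nlinarith [norm_nonneg B]
    · rw [norm_neg]
      nlinarith [norm_nonneg A]

/-- A weak solution of `v'' + A v' + B v = 0` with bounded operators `A`, `B`, tested against a set
of vectors that determines the range of `P`, solves the equation strongly after application
of `P`. -/
theorem exists_strong_of_weak [InnerProductSpace ℂ X] [CompleteSpace X] {v : ℝ → X}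
    (hv : ContinuousOn v (Ici 0)) (A B P : X →L[ℂ] X) (v₁ : X) (D : Set X)
    (hD : ∀ x, (∀ ψ ∈ D, inner ℂ ψ x = 0) → P x = 0)
    (h2 : ∀ ψ ∈ D, ContDiffOn ℝ 2 (fun t => inner ℂ ψ (v t)) (Ici 0))
    (h1 : ∀ ψ ∈ D, ContDiffOn ℝ 1 (fun t => inner ℂ ψ (A (v t))) (Ici 0))
    (hinit : ∀ ψ ∈ D, derivWithin (fun t => inner ℂ ψ (v t)) (Ici 0) 0 = inner ℂ ψ v₁)
    (heq : ∀ ψ ∈ D, ∀ t, 0 ≤ t → iteratedDerivWithin 2 (fun t => inner ℂ ψ (v t)) (Ici 0) t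
      + inner ℂ ψ (B (v t)) + derivWithin (fun t => inner ℂ ψ (A (v t))) (Ici 0) t = 0) :
    ∃ z : ℝ → X, z 0 = v₁ + A (v 0) ∧
      (∀ t, 0 ≤ t → HasDerivWithinAt z (-B (v t)) (Ici 0) t) ∧
      ∀ t, 0 ≤ t → HasDerivWithinAt (fun t => P (v t)) (P (z t - A (v t))) (Ici 0) t := by
  -- Constant extension to negative times, so that the integrals below are differentiable on the
  -- whole line.
  set V : ℝ → X := fun t => v (max t 0)
  have hV : Continuous V := hv.comp_continuous (by fun_prop) fun t => le_max_right t 0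
  have hVv (t : ℝ) (ht : 0 ≤ t) : V t = v t := by simp only [V, max_eq_left ht]
  -- The equation integrated once: `z` stands for `v' + A v` without requiring `v` to be
  -- differentiable in norm.
  set z : ℝ → X := fun t => v₁ + A (v 0) - ∫ s in (0 : ℝ)..t, B (V s)
  have hBV : Continuous fun t => B (V t) := B.continuous.comp hV
  have hz (t : ℝ) : HasDerivAt z (-B (V t)) t := by
    have := (hBV.integral_hasStrictDerivAt 0 t).hasDerivAt.const_sub (v₁ + A (v 0))
    exact this
  have hzc : Continuous z := continuous_iff_continuousAt.2 fun t => (hz t).continuousAt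
  set q : ℝ → X := fun t => z t - A (V t)
  have hq : Continuous q := hzc.sub (A.continuous.comp hV)
  set Q : ℝ → X := fun t => v 0 + ∫ s in (0 : ℝ)..t, q s
  have hQ (t : ℝ) : HasDerivAt Q (q t) t :=
    (hq.integral_hasStrictDerivAt 0 t).hasDerivAt.const_add (v 0)
  have hin (ψ : X) {F : ℝ → X} {F' : X} {t : ℝ} (hF : HasDerivAt F F' t) :
      HasDerivAt (fun t => inner ℂ ψ (F t)) (inner ℂ ψ F') t :=
    ((innerSL ℂ ψ).restrictScalars ℝ).hasFDerivAt.comp_hasDerivAt t hF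
  have hud := uniqueDiffOn_Ici (0 : ℝ)
  -- Integrating the tested equation twice shows that `v` and `Q` have the same inner products with
  -- `D`, which determine the image under `P`.
  have key (t : ℝ) (ht : 0 ≤ t) : P (v t) = P (Q t) := by
    rw [← sub_eq_zero, ← map_sub]
    refine hD _ fun ψ hψ => ?_
    rw [inner_sub_right, sub_eq_zero]
    have hf1 := (contDiffOn_succ_iff_derivWithin (n := 1) hud).1 (by simpa using! h2 ψ hψ)
    have hf2 := hf1.2.2.differentiableOn one_ne_zero
    have hg1 := (h1 ψ hψ).differentiableOn one_ne_zero
    have hfirst (τ : ℝ) (hτ : 0 ≤ τ) :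
        derivWithin (fun t => inner ℂ ψ (v t)) (Ici 0) τ + inner ℂ ψ (A (v τ))
          = inner ℂ ψ (z τ) := by
      refine eq_of_hasDerivWithinAt_Ici_eq (f' := fun τ => -inner ℂ ψ (B (v τ)))
        (f := fun τ => derivWithin (fun t => inner ℂ ψ (v t)) (Ici 0) τ + inner ℂ ψ (A (v τ)))
        (g := fun τ => inner ℂ ψ (z τ)) (fun τ hτ => ?_) (fun τ hτ => ?_) ?_ hτ
      · refine ((hf2 τ hτ).hasDerivWithinAt.add (hg1 τ hτ).hasDerivWithinAt).congr_deriv ?_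
        have := heq ψ hψ τ hτ
        rw [show (2 : ℕ) = 1 + 1 from rfl, iteratedDerivWithin_succ, iteratedDerivWithin_one] at this
        linear_combination this
      · refine ((hin ψ (hz τ)).hasDerivWithinAt).congr_deriv ?_
        rw [hVv τ hτ, inner_neg_right]
      · simp only [hinit ψ hψ, z, intervalIntegral.integral_same, sub_zero, inner_add_right]
    refine eq_of_hasDerivWithinAt_Ici_eq (f' := fun τ => inner ℂ ψ (q τ))
        (f := fun τ => inner ℂ ψ (v τ)) (g := fun τ => inner ℂ ψ (Q τ))
        (fun τ hτ => ?_) (fun τ _ => (hin ψ (hQ τ)).hasDerivWithinAt) ?_ ht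
    · refine (hf1.1 τ hτ).hasDerivWithinAt.congr_deriv ?_
      simp only [q, hVv τ hτ, inner_sub_right, ← hfirst τ hτ, add_sub_cancel_right]
    · simp only [Q, intervalIntegral.integral_same, add_zero]
  refine ⟨z, by simp [z], fun t ht => ?_, fun t ht => ?_⟩
  · rw [← hVv t ht]
    exact (hz t).hasDerivWithinAt
  · have h : HasDerivAt (fun t => P (Q t)) (P (q t)) t :=
      (P.restrictScalars ℝ).hasFDerivAt.comp_hasDerivAt t (hQ t)
    simp only [q, hVv t ht] at h
    exact h.hasDerivWithinAt.congr (fun τ hτ => key τ hτ) (key t ht)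

end Abstract

/-! ### Truncated Fourier multipliers and test functions -/

section Multiplication

variable {α : Type*} [MeasurableSpace α] {μ : Measure α}

theorem memLp_ofReal_mul_of_bounded {m : α → ℝ} (hm : Measurable m) {A : ℝ} (hA : ∀ x, |m x| ≤ A)
    {f : α → ℂ} (hf : MemLp f 2 μ) : MemLp (fun x => (m x : ℂ) * f x) 2 μ := by
  refine (hf.const_mul (A : ℂ)).of_le
    ((Complex.measurable_ofReal.comp hm).aestronglyMeasurable.mul hf.aestronglyMeasurable)
    (ae_of_all _ fun x => ?_)
  rw [norm_mul, norm_mul, Complex.norm_real, Complex.norm_real, Real.norm_eq_abs, Real.norm_eq_abs]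
  exact mul_le_mul_of_nonneg_right ((hA x).trans (le_abs_self A)) (norm_nonneg _)

/-- Multiplication by a bounded measurable real function on `L²`. -/
def boundedMul (μ : Measure α) {m : α → ℝ} (hm : Measurable m) {A : ℝ} (hA : ∀ x, |m x| ≤ A) :
    Lp ℂ 2 μ →L[ℂ] Lp ℂ 2 μ :=
  LinearMap.mkContinuous
    { toFun := fun f => (memLp_ofReal_mul_of_bounded hm hA (Lp.memLp f)).toLp _
      map_add' := fun f g => by
        rw [← MemLp.toLp_add]
        refine MemLp.toLp_congr _ _ ?_
        filter_upwards [Lp.coeFn_add f g] with x hx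
        simp only [hx, Pi.add_apply, mul_add]
      map_smul' := fun c f => by
        rw [RingHom.id_apply, ← MemLp.toLp_const_smul]
        refine MemLp.toLp_congr _ _ ?_
        filter_upwards [Lp.coeFn_smul c f] with x hx
        simp only [hx, Pi.smul_apply, smul_eq_mul]
        ring } A fun f => by
      refine Lp.norm_le_mul_norm_of_ae_le_mul ?_
      filter_upwards [MemLp.coeFn_toLp (memLp_ofReal_mul_of_bounded hm hA (Lp.memLp f))] with x hx
      simp only [LinearMap.coe_mk, AddHom.coe_mk]
      rw [hx, norm_mul, Complex.norm_real, Real.norm_eq_abs]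
      gcongr
      exact hA x

theorem coeFn_boundedMul {m : α → ℝ} (hm : Measurable m) {A : ℝ} (hA : ∀ x, |m x| ≤ A)
    (f : Lp ℂ 2 μ) : boundedMul μ hm hA f =ᵐ[μ] fun x => (m x : ℂ) * f x :=
  MemLp.coeFn_toLp (memLp_ofReal_mul_of_bounded hm hA (Lp.memLp f))

theorem boundedMul_comm {m m' : α → ℝ} (hm : Measurable m) {A : ℝ} (hA : ∀ x, |m x| ≤ A)
    (hm' : Measurable m') {A' : ℝ} (hA' : ∀ x, |m' x| ≤ A') (f : Lp ℂ 2 μ) :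
    boundedMul μ hm hA (boundedMul μ hm' hA' f) = boundedMul μ hm' hA' (boundedMul μ hm hA f) := by
  refine Lp.ext ?_
  filter_upwards [coeFn_boundedMul hm hA (boundedMul μ hm' hA' f), coeFn_boundedMul hm' hA' f,
    coeFn_boundedMul hm' hA' (boundedMul μ hm hA f), coeFn_boundedMul hm hA f] with x h1 h2 h3 h4
  rw [h1, h2, h3, h4]
  ring

end Multiplication

open scoped ContDiff in
/-- The smooth real functions with compact support in the ball of radius `R`, as vectors
of `L²`. -/
def bumpVectors (n : ℕ) (R : ℝ) : Set (L2 n) :=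
  {x | ∃ (g : EuclideanSpace ℝ (Fin n) → ℝ) (h₁ : HasCompactSupport (Complex.ofRealCLM ∘ g))
    (h₂ : ContDiff ℝ ∞ (Complex.ofRealCLM ∘ g)), tsupport g ⊆ Metric.ball 0 R ∧
    x = (h₁.toSchwartzMap h₂).toLp 2 volume}

/-- The function `(2π|ξ|)^β` on the ball of radius `R`, extended by zero. -/
def truncatedPow (n : ℕ) (R β : ℝ) : EuclideanSpace ℝ (Fin n) → ℝ :=
  (Metric.ball 0 R).indicator fun ξ => (2 * Real.pi * ‖ξ‖) ^ β

theorem measurable_truncatedPow (n : ℕ) (R β : ℝ) : Measurable (truncatedPow n R β) :=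
  ((measurable_norm.const_mul _).pow_const β).indicator measurableSet_ball

theorem abs_truncatedPow_le {n : ℕ} {R β : ℝ} (hR : 0 < R) (hβ : 0 ≤ β)
    (ξ : EuclideanSpace ℝ (Fin n)) : |truncatedPow n R β ξ| ≤ (2 * Real.pi * R) ^ β := by
  have hpi := Real.pi_pos
  rw [truncatedPow]
  by_cases h : ξ ∈ Metric.ball 0 R
  · rw [indicator_of_mem h, abs_of_nonneg (by positivity)]
    have : ‖ξ‖ ≤ R := (mem_ball_zero_iff.1 h).le
    gcongr
  · rw [indicator_of_notMem h, abs_zero]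
    positivity

/-- Multiplication by `(2π|ξ|)^β` on the ball of radius `R`. -/
def truncatedMul (n : ℕ) {R β : ℝ} (hR : 0 < R) (hβ : 0 ≤ β) : L2 n →L[ℂ] L2 n :=
  boundedMul volume (measurable_truncatedPow n R β) (abs_truncatedPow_le hR hβ)

theorem coeFn_truncatedMul {n : ℕ} {R β : ℝ} (hR : 0 < R) (hβ : 0 ≤ β) (f : L2 n) :
    truncatedMul n hR hβ f =ᵐ[volume] fun ξ => (truncatedPow n R β ξ : ℂ) * f ξ :=
  coeFn_boundedMul _ _ f

/-- The fundamental lemma of the calculus of variations kills `x` on the open ball, and the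
multiplier vanishes off it. -/
theorem truncatedMul_eq_zero_of_bumpVectors {n : ℕ} {R β : ℝ} (hR : 0 < R) (hβ : 0 ≤ β) {x : L2 n}
    (hx : ∀ ψ ∈ bumpVectors n R, inner ℂ ψ x = 0) : truncatedMul n hR hβ x = 0 := by
  have h : ∀ᵐ ξ, ξ ∈ Metric.ball (0 : EuclideanSpace ℝ (Fin n)) R → x ξ = 0 := by
    refine Metric.isOpen_ball.ae_eq_zero_of_integral_contDiff_smul_eq_zero
      (((Lp.memLp x).locallyIntegrable (by norm_num)).locallyIntegrableOn _) fun g hg hgc hgs => ?_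
    have h₁ : HasCompactSupport (Complex.ofRealCLM ∘ g) := hgc.comp_left rfl
    have h₂ : ContDiff ℝ _ (Complex.ofRealCLM ∘ g) := Complex.ofRealCLM.contDiff.comp hg
    rw [← hx _ ⟨g, h₁, h₂, hgs, rfl⟩, L2.inner_def]
    refine integral_congr_ae ?_
    filter_upwards [(h₁.toSchwartzMap h₂).coeFn_toLp 2 volume] with ξ hξ
    rw [hξ]
    simp [RCLike.inner_apply, mul_comm]
  refine Lp.ext ?_
  filter_upwards [h, coeFn_truncatedMul hR hβ x, Lp.coeFn_zero ℂ 2 volume] with ξ h1 h2 h3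
  rw [h2, h3, truncatedPow]
  by_cases hξ : ξ ∈ Metric.ball 0 R
  · rw [h1 hξ, mul_zero, Pi.zero_apply]
  · rw [indicator_of_notMem hξ]
    simp

theorem inner_schwartz_eq_inner_fourier {n : ℕ} (ψ : 𝓢(EuclideanSpace ℝ (Fin n), ℂ)) (f : L2 n) :
    inner ℂ ((𝓕⁻ ψ : 𝓢(EuclideanSpace ℝ (Fin n), ℂ)).toLp 2 volume) f
      = inner ℂ (ψ.toLp 2 volume) (𝓕 f : L2 n) := by
  rw [← Lp.inner_fourier_eq, SchwartzMap.toLp_fourier_eq, FourierTransform.fourier_fourierInv_eq]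

/-- The test function lives on the ball, so truncating the symbol there changes nothing, and a real
symbol can be moved to the other factor. -/
theorem inner_fracLaplacian_eq {n : ℕ} {R a : ℝ} (hR : 0 < R) (ha : 0 ≤ a)
    {g : EuclideanSpace ℝ (Fin n) → ℝ} (h₁ : HasCompactSupport (Complex.ofRealCLM ∘ g))
    (h₂ : ContDiff ℝ _ (Complex.ofRealCLM ∘ g)) (hg : tsupport g ⊆ Metric.ball 0 R) (f : L2 n) :
    inner ℂ (fracLaplacian a ((𝓕⁻ (h₁.toSchwartzMap h₂) :
      𝓢(EuclideanSpace ℝ (Fin n), ℂ)).toLp 2 volume)) f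
      = inner ℂ ((h₁.toSchwartzMap h₂).toLp 2 volume)
        (truncatedMul n hR (by positivity : 0 ≤ 2 * a) (𝓕 f : L2 n)) := by
  rw [← Lp.inner_fourier_eq, L2.inner_def, L2.inner_def]
  refine integral_congr_ae ?_
  have hF := fourier_absD (inDomAbsD_schwartz (s := 2 * a) (by positivity)
    (𝓕⁻ (h₁.toSchwartzMap h₂) : 𝓢(EuclideanSpace ℝ (Fin n), ℂ)))
  rw [SchwartzMap.toLp_fourier_eq, FourierTransform.fourier_fourierInv_eq] at hF
  filter_upwards [hF, (h₁.toSchwartzMap h₂).coeFn_toLp 2 volume,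
    coeFn_truncatedMul hR (by positivity : 0 ≤ 2 * a) (𝓕 f : L2 n)] with ξ e1 e2 e3
  rw [fracLaplacian, e1, e2, e3, truncatedPow]
  by_cases hξ : ξ ∈ Metric.ball 0 R
  · rw [indicator_of_mem hξ]
    simp only [RCLike.inner_apply, map_mul, Complex.conj_ofReal]
    ring
  · have : g ξ = 0 := image_eq_zero_of_notMem_tsupport fun h => hξ (hg h)
    simp [this]

/-! ### The Fourier transform of a weak solution -/

theorem measurable_dampedSol {α : Type*} [MeasurableSpace α] {a b : α → ℝ} {y₀ y₁ : α → ℂ}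
    (ha : Measurable a) (hb : Measurable b) (h₀ : Measurable y₀) (h₁ : Measurable y₁)
    (k : ℕ) (t : ℝ) : Measurable fun x => dampedSol (a x) (b x) (y₀ x) (y₁ x) k t := by
  have hd : Measurable fun x => charDisc (a x) (b x) :=
    (Complex.measurable_ofReal.comp ((ha.pow_const 2).sub (hb.const_mul 4))).pow_const _
  have hac : Measurable fun x => (a x : ℂ) := Complex.measurable_ofReal.comp ha
  have hs : Measurable fun x => slowRoot (a x) (b x) := (hac.neg.add hd).div_const 2
  have hf : Measurable fun x => fastRoot (a x) (b x) := (hac.neg.sub hd).div_const 2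
  exact (((h₁.sub (hf.mul h₀)).mul ((hs.pow_const k).mul
    (Complex.measurable_exp.comp (hs.mul_const _)))).sub
    ((h₁.sub (hs.mul h₀)).mul ((hf.pow_const k).mul
    (Complex.measurable_exp.comp (hf.mul_const _))))).div hd

/-- The `k`-th time derivative of the Fourier transform of the solution of the Cauchy problem
with transformed data `y₀`, `y₁`. -/
def fourierSol {n : ℕ} (σ δ : ℝ) (y₀ y₁ : EuclideanSpace ℝ (Fin n) → ℂ) (k : ℕ) (t : ℝ)
    (ξ : EuclideanSpace ℝ (Fin n)) : ℂ :=
  dampedSol ((2 * Real.pi * ‖ξ‖) ^ (2 * δ)) ((2 * Real.pi * ‖ξ‖) ^ (2 * σ)) (y₀ ξ) (y₁ ξ) k t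

theorem measurable_fourierSol {n : ℕ} (σ δ : ℝ) {y₀ y₁ : EuclideanSpace ℝ (Fin n) → ℂ}
    (h₀ : Measurable y₀) (h₁ : Measurable y₁) (k : ℕ) (t : ℝ) :
    Measurable (fourierSol σ δ y₀ y₁ k t) :=
  measurable_dampedSol ((measurable_norm.const_mul _).pow_const _)
    ((measurable_norm.const_mul _).pow_const _) h₀ h₁ k t

theorem fourierSol_at_zero {n : ℕ} {σ δ : ℝ} (hδ : 0 < δ) (hσ : 0 < σ)
    (y₀ y₁ : EuclideanSpace ℝ (Fin n) → ℂ) (k : ℕ) (t : ℝ) : fourierSol σ δ y₀ y₁ k t 0 = 0 := by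
  rw [fourierSol, norm_zero, mul_zero, Real.zero_rpow (by positivity),
    Real.zero_rpow (by positivity)]
  exact dampedSol_of_disc_eq (by norm_num) _ _ k t

/-- The discriminant `r^(4δ) - 4 r^(2σ)` vanishes only at the origin and on the sphere `r^(2σ-4δ) =
1/4`. -/
theorem ae_disc_ne_zero {n : ℕ} {σ δ : ℝ} (hδσ : δ < σ / 2) (hn : 0 < n) :
    ∀ᵐ ξ : EuclideanSpace ℝ (Fin n),
      ((2 * Real.pi * ‖ξ‖) ^ (2 * δ)) ^ 2 ≠ 4 * (2 * Real.pi * ‖ξ‖) ^ (2 * σ) := by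
  have hpi := Real.pi_pos
  have : Nonempty (Fin n) := ⟨⟨0, hn⟩⟩
  have h0 : volume ({0} : Set (EuclideanSpace ℝ (Fin n))) = 0 := measure_singleton _
  have h1 := Measure.addHaar_sphere volume (0 : EuclideanSpace ℝ (Fin n))
    ((1 / 4) ^ (1 / (2 * σ - 4 * δ)) / (2 * Real.pi))
  filter_upwards [measure_eq_zero_iff_ae_notMem.1 h0, measure_eq_zero_iff_ae_notMem.1 h1]
    with ξ hξ hξ' heq
  refine hξ' ?_
  have hr : 0 < 2 * Real.pi * ‖ξ‖ := by
    have : 0 < ‖ξ‖ := norm_pos_iff.2 hξ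
    positivity
  rw [mem_sphere_zero_iff_norm, eq_div_iff (by positivity), mul_comm ‖ξ‖]
  set r := 2 * Real.pi * ‖ξ‖
  have h2 : r ^ (2 * σ - 4 * δ) = 1 / 4 := by
    rw [Real.rpow_sub hr, div_eq_iff (by positivity)]
    rw [← Real.rpow_mul_natCast hr.le, show 2 * δ * ((2 : ℕ) : ℝ) = 4 * δ by push_cast; ring] at heq
    linarith
  rw [← h2, ← Real.rpow_mul hr.le, mul_one_div_cancel (by linarith), Real.rpow_one]

/-- The bound on `r^(2σ)` times the solution is uniform in time, unlike that on the solution alone;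
this dominates the second derivative, given by the equation. -/
theorem norm_fourierSol_bounded {n : ℕ} {σ δ R : ℝ} (hδ : 0 < δ) (hσ : 0 < σ) (hR : 0 < R) :
    ∃ A, 0 ≤ A ∧ ∀ (y₀ y₁ : EuclideanSpace ℝ (Fin n) → ℂ) (ξ), ‖ξ‖ < R → ∀ t, 0 ≤ t →
      (2 * Real.pi * ‖ξ‖) ^ (2 * δ) ≤ A ∧ (2 * Real.pi * ‖ξ‖) ^ (2 * σ) ≤ A ∧
      ‖fourierSol σ δ y₀ y₁ 1 t ξ‖ ≤ 2 * (1 + A) * (‖y₀ ξ‖ + ‖y₁ ξ‖) ∧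
      (2 * Real.pi * ‖ξ‖) ^ (2 * σ) * ‖fourierSol σ δ y₀ y₁ 0 t ξ‖
        ≤ 2 * (1 + A) ^ 2 * (‖y₀ ξ‖ + ‖y₁ ξ‖) ∧
      ‖fourierSol σ δ y₀ y₁ 0 t ξ‖ ≤ (1 + 2 * (1 + A) * t) * (‖y₀ ξ‖ + ‖y₁ ξ‖) := by
  have hpi := Real.pi_pos
  refine ⟨(2 * Real.pi * R) ^ (2 * δ) + (2 * Real.pi * R) ^ (2 * σ), by positivity,
    fun y₀ y₁ ξ hξ t ht => ?_⟩
  set A := (2 * Real.pi * R) ^ (2 * δ) + (2 * Real.pi * R) ^ (2 * σ)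
  have hA : 0 ≤ A := by positivity
  have ha : (2 * Real.pi * ‖ξ‖) ^ (2 * δ) ≤ A :=
    (Real.rpow_le_rpow (by positivity) (by gcongr) (by positivity)).trans
      (le_add_of_nonneg_right (by positivity))
  have hb : (2 * Real.pi * ‖ξ‖) ^ (2 * σ) ≤ A :=
    (Real.rpow_le_rpow (by positivity) (by gcongr) (by positivity)).trans
      (le_add_of_nonneg_left (by positivity))
  refine ⟨ha, hb, ?_⟩
  rcases eq_or_ne ξ 0 with rfl | h0
  · simp only [fourierSol_at_zero hδ hσ, norm_zero, mul_zero]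
    exact ⟨by positivity, by positivity, by positivity⟩
  · have hr : 0 < 2 * Real.pi * ‖ξ‖ := by
      have : 0 < ‖ξ‖ := norm_pos_iff.2 h0
      positivity
    have h1 := norm_dampedSol_bounded (by positivity) (by positivity) ha hb (y₀ ξ) (y₁ ξ) ht
    exact ⟨h1.1, h1.2, norm_dampedSol_zero_le (by positivity) (by positivity) ha hb _ _ ht⟩

/-- The Fourier transform of a weak solution is given by the explicit solution of the transformed
equation. -/
theorem fourier_ae_eq_fourierSol {n : ℕ} {σ δ : ℝ} (hδ : 0 < δ) (hδσ : δ < σ / 2) (hn : 0 < n)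
    {u₀ u₁ : L2 n} {u : ℝ → L2 n} (hu : IsSobolevSolution σ δ u₀ u₁ u)
    {y₀ y₁ : EuclideanSpace ℝ (Fin n) → ℂ} (hm₀ : Measurable y₀) (hm₁ : Measurable y₁)
    (h₀ : (𝓕 u₀ : L2 n) =ᵐ[volume] y₀) (h₁ : (𝓕 u₁ : L2 n) =ᵐ[volume] y₁) {t : ℝ} (ht : 0 ≤ t) :
    (𝓕 (u t) : L2 n) =ᵐ[volume] fourierSol σ δ y₀ y₁ 0 t := by
  have hσ : 0 < σ := by linarith
  -- On each ball of frequencies both multipliers are bounded; countably many balls cover the space.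
  suffices H : ∀ R : ℕ, ∀ᵐ ξ, ξ ∈ Metric.ball (0 : EuclideanSpace ℝ (Fin n)) (R + 1) →
      (𝓕 (u t) : L2 n) ξ = fourierSol σ δ y₀ y₁ 0 t ξ by
    filter_upwards [ae_all_iff.2 H] with ξ hξ
    obtain ⟨R, hR⟩ := exists_nat_gt ‖ξ‖
    exact hξ R (mem_ball_zero_iff.2 (by linarith))
  intro R'
  set R : ℝ := R' + 1
  have hR : 0 < R := by positivity
  set v : ℝ → L2 n := fun t => 𝓕 (u t)
  have hv : ContinuousOn v (Ici 0) :=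
    (Lp.fourierTransformₗᵢ (EuclideanSpace ℝ (Fin n)) ℂ).continuous.comp_continuousOn
      hu.continuousOn
  set A := truncatedMul n hR (by positivity : 0 ≤ 2 * δ)
  set B := truncatedMul n hR (by positivity : 0 ≤ 2 * σ)
  -- With exponent zero this is restriction to the ball, origin included since `0 ^ 0 = 1`.
  set P := truncatedMul n hR (le_refl (0 : ℝ))
  obtain ⟨z, hz0, hz, hPv⟩ := exists_strong_of_weak hv A B P (𝓕 u₁) (bumpVectors n R)
    (fun x hx => truncatedMul_eq_zero_of_bumpVectors hR le_rfl hx)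
    (by
      rintro _ ⟨g, h₁, h₂, hg, rfl⟩
      refine (hu.contDiffOn (𝓕⁻ (h₁.toSchwartzMap h₂))).congr fun τ _ => ?_
      exact (inner_schwartz_eq_inner_fourier _ _).symm)
    (by
      rintro _ ⟨g, h₁, h₂, hg, rfl⟩
      refine (hu.contDiffOn_damping (𝓕⁻ (h₁.toSchwartzMap h₂))).congr fun τ _ => ?_
      exact (inner_fracLaplacian_eq hR hδ.le h₁ h₂ hg _).symm)
    (by
      rintro _ ⟨g, h₁, h₂, hg, rfl⟩
      have := hu.initial_velocity (𝓕⁻ (h₁.toSchwartzMap h₂))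
      simp only [inner_schwartz_eq_inner_fourier] at this
      exact this)
    (by
      rintro _ ⟨g, h₁, h₂, hg, rfl⟩ τ hτ
      have := hu.equation (𝓕⁻ (h₁.toSchwartzMap h₂)) τ hτ
      simp only [inner_schwartz_eq_inner_fourier, inner_fracLaplacian_eq hR hδ.le h₁ h₂ hg,
        inner_fracLaplacian_eq hR hσ.le h₁ h₂ hg] at this
      exact this)
  -- the explicit solution
  obtain ⟨K, hK, hbd⟩ := norm_fourierSol_bounded (n := n) hδ hσ hR
  set χ : EuclideanSpace ℝ (Fin n) → ℂ := fun ξ => (truncatedPow n R 0 ξ : ℂ)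
  set a : EuclideanSpace ℝ (Fin n) → ℝ := fun ξ => (2 * Real.pi * ‖ξ‖) ^ (2 * δ)
  set b : EuclideanSpace ℝ (Fin n) → ℝ := fun ξ => (2 * Real.pi * ‖ξ‖) ^ (2 * σ)
  set Y : ℕ → ℝ → EuclideanSpace ℝ (Fin n) → ℂ := fourierSol σ δ y₀ y₁
  have hχ (ξ : EuclideanSpace ℝ (Fin n)) : (‖ξ‖ < R ∧ χ ξ = 1) ∨ (χ ξ = 0 ∧
      ∀ β, truncatedPow n R β ξ = 0) := by
    by_cases h : ξ ∈ Metric.ball 0 R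
    · exact Or.inl ⟨mem_ball_zero_iff.1 h, by simp [χ, truncatedPow, indicator_of_mem h]⟩
    · exact Or.inr ⟨by simp [χ, truncatedPow, indicator_of_notMem h],
        fun β => by simp [truncatedPow, indicator_of_notMem h]⟩
  have htr (β : ℝ) (ξ : EuclideanSpace ℝ (Fin n)) :
      (truncatedPow n R β ξ : ℂ) = ((2 * Real.pi * ‖ξ‖) ^ β : ℝ) * χ ξ := by
    simp only [χ, truncatedPow]
    by_cases h : ξ ∈ Metric.ball 0 R
    · simp [indicator_of_mem h]
    · simp [indicator_of_notMem h]
  have hχ2 (ξ : EuclideanSpace ℝ (Fin n)) : χ ξ * χ ξ = χ ξ := by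
    rcases hχ ξ with h | h
    · simp [h.2]
    · simp [h.1]
  have hχm : Measurable χ := Complex.measurable_ofReal.comp (measurable_truncatedPow n R 0)
  have ham : Measurable a := (measurable_norm.const_mul _).pow_const _
  have hbm : Measurable b := (measurable_norm.const_mul _).pow_const _
  have hYm (k : ℕ) (τ : ℝ) : Measurable (Y k τ) := measurable_fourierSol σ δ hm₀ hm₁ k τ
  have hYd (k : ℕ) (ξ : EuclideanSpace ℝ (Fin n)) (τ : ℝ) :
      HasDerivAt (fun τ => Y k τ ξ) (Y (k + 1) τ ξ) τ := hasDerivAt_dampedSol _ _ _ _ k τ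
  have hY2 (ξ : EuclideanSpace ℝ (Fin n)) (τ : ℝ) :
      Y 2 τ ξ = -a ξ * Y 1 τ ξ - b ξ * Y 0 τ ξ := dampedSol_add_two _ _ _ _ 0 τ
  have hyS : MemLp (fun ξ => ‖y₀ ξ‖ + ‖y₁ ξ‖) 2 volume :=
    ((memLp_congr_ae h₀).1 (Lp.memLp _)).norm.add ((memLp_congr_ae h₁).1 (Lp.memLp _)).norm
  have hmem0 (τ : ℝ) (hτ : 0 ≤ τ) : MemLp (fun ξ => χ ξ * Y 0 τ ξ) 2 volume := by
    refine (hyS.const_mul (1 + 2 * (1 + K) * τ)).mono' (hχm.mul (hYm 0 τ)).aestronglyMeasurable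
      (ae_of_all _ fun ξ => ?_)
    rcases hχ ξ with h | h
    · rw [h.2, one_mul]
      exact (hbd y₀ y₁ ξ h.1 τ hτ).2.2.2.2
    · rw [h.1, zero_mul, norm_zero]
      positivity
  have hmem1 (τ : ℝ) (hτ : 0 ≤ τ) : MemLp (fun ξ => χ ξ * Y 1 τ ξ) 2 volume := by
    refine (hyS.const_mul (2 * (1 + K))).mono' (hχm.mul (hYm 1 τ)).aestronglyMeasurable
      (ae_of_all _ fun ξ => ?_)
    rcases hχ ξ with h | h
    · rw [h.2, one_mul]
      exact (hbd y₀ y₁ ξ h.1 τ hτ).2.2.1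
    · rw [h.1, zero_mul, norm_zero]
      positivity
  classical
  set W₀ : ℝ → L2 n := fun τ => if h : 0 ≤ τ then (hmem0 τ h).toLp _ else 0
  set W₁ : ℝ → L2 n := fun τ => if h : 0 ≤ τ then (hmem1 τ h).toLp _ else 0
  have hW₀ (τ : ℝ) (hτ : 0 ≤ τ) : W₀ τ =ᵐ[volume] fun ξ => χ ξ * Y 0 τ ξ := by
    simp only [W₀, dif_pos hτ]
    exact MemLp.coeFn_toLp _
  have hW₁ (τ : ℝ) (hτ : 0 ≤ τ) : W₁ τ =ᵐ[volume] fun ξ => χ ξ * Y 1 τ ξ := by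
    simp only [W₁, dif_pos hτ]
    exact MemLp.coeFn_toLp _
  have hAW (τ : ℝ) (hτ : 0 ≤ τ) : A (W₀ τ) =ᵐ[volume] fun ξ => χ ξ * (a ξ * Y 0 τ ξ) := by
    filter_upwards [coeFn_truncatedMul hR (by positivity : 0 ≤ 2 * δ) (W₀ τ), hW₀ τ hτ]
      with ξ e1 e2
    rw [e1, e2, htr]
    linear_combination ((a ξ : ℂ) * Y 0 τ ξ) * hχ2 ξ
  have hBW (τ : ℝ) (hτ : 0 ≤ τ) : (-B (W₀ τ) : L2 n) =ᵐ[volume]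
      fun ξ => χ ξ * (-b ξ * Y 0 τ ξ) := by
    filter_upwards [coeFn_truncatedMul hR (by positivity : 0 ≤ 2 * σ) (W₀ τ), hW₀ τ hτ,
      Lp.coeFn_neg (B (W₀ τ))] with ξ e1 e2 e3
    rw [e3, Pi.neg_apply, e1, e2, htr]
    linear_combination (-(b ξ : ℂ) * Y 0 τ ξ) * hχ2 ξ
  -- The counterpart of `z` for the explicit solution, `W₀' + A W₀`.
  set Z : ℝ → L2 n := fun τ => W₁ τ + A (W₀ τ)
  have hZ (τ : ℝ) (hτ : 0 ≤ τ) : Z τ =ᵐ[volume] fun ξ => χ ξ * (Y 1 τ ξ + a ξ * Y 0 τ ξ) := by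
    filter_upwards [Lp.coeFn_add (W₁ τ) (A (W₀ τ)), hW₁ τ hτ, hAW τ hτ] with ξ e1 e2 e3
    rw [e1, Pi.add_apply, e2, e3]
    ring
  have hWd (τ : ℝ) (hτ : 0 ≤ τ) : HasDerivWithinAt W₀ (Z τ - A (W₀ τ)) (Ici 0) τ := by
    rw [show Z τ - A (W₀ τ) = W₁ τ by simp only [Z]; abel]
    refine Lp_hasDerivWithinAt_of_dominated (convex_Ici 0) (Φ₂ := fun τ ξ => χ ξ * Y 2 τ ξ)
      (hyS.const_mul (K * (2 * (1 + K)) + 2 * (1 + K) ^ 2)) hW₀ hW₁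
      (fun ξ τ _ => ((hYd 0 ξ τ).const_mul (χ ξ)).hasDerivWithinAt)
      (fun ξ τ _ => ((hYd 1 ξ τ).const_mul (χ ξ)).hasDerivWithinAt) (fun ξ τ hτ => ?_) hτ
    rcases hχ ξ with h | h
    · obtain ⟨i1, i2, i3, i4, -⟩ := hbd y₀ y₁ ξ h.1 τ hτ
      rw [h.2, one_mul, hY2]
      refine (norm_sub_le _ _).trans ?_
      rw [norm_mul, norm_mul, norm_neg, Complex.norm_real, Complex.norm_real,
        Real.norm_of_nonneg (by positivity), Real.norm_of_nonneg (by positivity), add_mul,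
        mul_assoc K]
      exact add_le_add (mul_le_mul i1 i3 (norm_nonneg _) hK) i4
    · rw [h.1, zero_mul, norm_zero]
      positivity
  have hZd (τ : ℝ) (hτ : 0 ≤ τ) : HasDerivWithinAt Z (-B (W₀ τ)) (Ici 0) τ := by
    refine Lp_hasDerivWithinAt_of_dominated (convex_Ici 0)
      (g := fun τ => -B (W₀ τ)) (Φ₂ := fun τ ξ => χ ξ * (-b ξ * Y 1 τ ξ))
      (hyS.const_mul (K * (2 * (1 + K)))) hZ hBW
      (fun ξ τ _ => ?_)
      (fun ξ τ _ => (((hYd 0 ξ τ).const_mul (-b ξ : ℂ)).const_mul (χ ξ)).hasDerivWithinAt)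
      (fun ξ τ hτ => ?_) hτ
    · have := (((hYd 1 ξ τ).add ((hYd 0 ξ τ).const_mul (a ξ : ℂ))).const_mul
        (χ ξ)).hasDerivWithinAt (s := Ici 0)
      refine this.congr_deriv ?_
      rw [hY2]
      ring
    · rcases hχ ξ with h | h
      · obtain ⟨i1, i2, i3, i4, -⟩ := hbd y₀ y₁ ξ h.1 τ hτ
        rw [h.2, one_mul, norm_mul, norm_neg, Complex.norm_real,
          Real.norm_of_nonneg (by positivity), mul_assoc K]
        exact mul_le_mul i2 i3 (norm_nonneg _) hK
      · rw [h.1, zero_mul, norm_zero]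
        positivity
  -- comparison
  have hcommA (x : L2 n) : P (A x) = A (P x) := boundedMul_comm _ _ _ _ x
  have hcommB (x : L2 n) : P (B x) = B (P x) := boundedMul_comm _ _ _ _ x
  have hP (x : L2 n) : P x =ᵐ[volume] fun ξ => χ ξ * x ξ := coeFn_truncatedMul hR le_rfl x
  have hW0 : W₀ 0 = P (v 0) := by
    refine Lp.ext ?_
    filter_upwards [hW₀ 0 le_rfl, hP (v 0), h₀, ae_disc_ne_zero hδσ hn] with ξ e1 e2 e3 e4
    rw [e1, e2]
    simp only [v, hu.initial_value, e3, Y, fourierSol, dampedSol_zero_zero e4]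
  have hW1 : W₁ 0 = P (𝓕 u₁) := by
    refine Lp.ext ?_
    filter_upwards [hW₁ 0 le_rfl, hP (𝓕 u₁), h₁, ae_disc_ne_zero hδσ hn] with ξ e1 e2 e3 e4
    rw [e1, e2, e3]
    simp only [Y, fourierSol, dampedSol_one_zero e4]
  have hPz (τ : ℝ) (hτ : 0 ≤ τ) : HasDerivWithinAt (fun τ => P (z τ)) (-B (P (v τ))) (Ici 0) τ := by
    have := (P.restrictScalars ℝ).hasFDerivAt.comp_hasDerivWithinAt τ (hz τ hτ)
    refine this.congr_deriv ?_
    rw [ContinuousLinearMap.coe_restrictScalars', map_neg, hcommB]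
  have hzero := eq_zero_of_damped_system A B (w := fun τ => P (v τ) - W₀ τ)
    (z := fun τ => P (z τ) - Z τ)
    (fun τ hτ => ((hPv τ hτ).sub (hWd τ hτ)).congr_deriv (by
      rw [map_sub, map_sub, hcommA]; abel))
    (fun τ hτ => ((hPz τ hτ).sub (hZd τ hτ)).congr_deriv (by rw [map_sub]; abel))
    (by rw [hW0, sub_self])
    (by
      simp only [Z]
      rw [hz0, map_add, hcommA, hW0, hW1, sub_self]) ht
  have hfin : P (v t) = W₀ t := sub_eq_zero.1 hzero
  filter_upwards [hP (v t), hW₀ t ht] with ξ e1 e2 hξ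
  rw [hfin, e2] at e1
  have : χ ξ = 1 := by
    rcases hχ ξ with h | h
    · exact h.2
    · have h2 := h.2 0
      rw [truncatedPow, indicator_of_mem hξ] at h2
      simp at h2
  rw [this, one_mul, one_mul] at e1
  exact e1.symm

/-! ### Fourier transforms of integrable data -/

section FourierIntegral

variable {n : ℕ} {f : EuclideanSpace ℝ (Fin n) → ℂ}

theorem continuous_fourierIntegral (hf : Integrable f) : Continuous (𝓕 f) :=
  VectorFourier.fourierIntegral_continuous (L := innerₗ (EuclideanSpace ℝ (Fin n)))
    Real.continuous_fourierChar continuous_inner hf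

theorem norm_fourierIntegral_le (f : EuclideanSpace ℝ (Fin n) → ℂ)
    (ξ : EuclideanSpace ℝ (Fin n)) : ‖𝓕 f ξ‖ ≤ ∫ x, ‖f x‖ :=
  VectorFourier.norm_fourierIntegral_le_integral_norm _ _ _ _ _

theorem fourierIntegral_zero (f : EuclideanSpace ℝ (Fin n) → ℂ) : 𝓕 f 0 = ∫ x, f x := by
  simp [Real.fourier_eq]

/-- On `L¹ ∩ L²`, the Fourier transform of `L²` is given by the Fourier integral. -/
theorem fourier_ae_eq_fourierIntegral (f : L2 n)
    (hf : Integrable (f : EuclideanSpace ℝ (Fin n) → ℂ)) :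
    (𝓕 f : L2 n) =ᵐ[volume] 𝓕 (f : EuclideanSpace ℝ (Fin n) → ℂ) := by
  refine ae_eq_of_integral_contDiff_smul_eq
    ((Lp.memLp (𝓕 f : L2 n)).locallyIntegrable (by norm_num))
    (continuous_fourierIntegral hf).locallyIntegrable fun g hg hgc => ?_
  have h₁ : HasCompactSupport (Complex.ofRealCLM ∘ g) := hgc.comp_left rfl
  have h₂ : ContDiff ℝ _ (Complex.ofRealCLM ∘ g) := Complex.ofRealCLM.contDiff.comp hg
  set φ := h₁.toSchwartzMap h₂
  have hφ (x : EuclideanSpace ℝ (Fin n)) (z : ℂ) : φ x • z = g x • z := by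
    simp [φ]
  -- Both transforms obey `∫ φ · 𝓕 f = ∫ 𝓕 φ · f`: for `L²` through tempered distributions, for the
  -- integral by Fubini in `e2`.
  have e1 := congrArg (fun T : 𝓢'(EuclideanSpace ℝ (Fin n), ℂ) => T φ)
    (Lp.fourier_toTemperedDistribution_eq f)
  simp only [TemperedDistribution.fourier_apply, Lp.toTemperedDistribution_apply, hφ] at e1
  rw [← e1]
  have e2 := VectorFourier.integral_fourierIntegral_smul_eq_flip
    (L := innerₗ (EuclideanSpace ℝ (Fin n))) (μ := volume) (ν := volume)
    Real.continuous_fourierChar continuous_inner φ.integrable hf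
  rw [flip_innerₗ] at e2
  calc _ = ∫ x, φ x • 𝓕 (f : EuclideanSpace ℝ (Fin n) → ℂ) x := e2
    _ = _ := by simp only [hφ]

end FourierIntegral

/-! ### Parabolic families and self-similar limits -/

/-- The bounds of a family of time derivatives that combine self-similar decay at low frequencies
with smoothing at high frequencies. -/
def IsParabolicFamily {n : ℕ} (σ δ s : ℝ) (Φ : ℕ → ℝ → EuclideanSpace ℝ (Fin n) → ℂ) : Prop :=
  ∀ k : ℕ, ∃ N₀ : ℝ, ∀ N ≥ N₀, ∃ C, 0 ≤ C ∧ ∀ t > 0, ∀ ξ,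
    ‖Φ k t ξ‖ ≤ C * ((t ^ k)⁻¹ * ((2 * Real.pi * ‖ξ‖) ^ (s - 2 * δ)
      * Real.exp (-(t / 2 * (2 * Real.pi * ‖ξ‖) ^ (2 * (σ - δ)))))
      + (2 * Real.pi * ‖ξ‖) ^ N * Real.exp (-(t / 20 * (2 * Real.pi * ‖ξ‖) ^ (2 * δ))))

namespace IsParabolicFamily

variable {n : ℕ} {σ δ s : ℝ} {Φ Ψ : ℕ → ℝ → EuclideanSpace ℝ (Fin n) → ℂ}

/-- Allowing every `N ≥ N₀` in the definition lets two families share one exponent. -/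
theorem sub_const_mul (hΦ : IsParabolicFamily σ δ s Φ) (hΨ : IsParabolicFamily σ δ s Ψ) (c : ℂ) :
    IsParabolicFamily σ δ s fun k t ξ => Φ k t ξ - c * Ψ k t ξ := by
  intro k
  obtain ⟨N₁, h₁⟩ := hΦ k
  obtain ⟨N₂, h₂⟩ := hΨ k
  refine ⟨max N₁ N₂, fun N hN => ?_⟩
  obtain ⟨C₁, hC₁, h₁⟩ := h₁ N (le_of_max_le_left hN)
  obtain ⟨C₂, hC₂, h₂⟩ := h₂ N (le_of_max_le_right hN)
  refine ⟨C₁ + ‖c‖ * C₂, by positivity, fun t ht ξ => ?_⟩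
  refine (norm_sub_le _ _).trans ?_
  rw [norm_mul, add_mul, mul_assoc ‖c‖]
  gcongr
  exacts [h₁ t ht ξ, h₂ t ht ξ]

/-- Every factor of the bound is nonincreasing in `t`, so its value at `t₀` dominates; `hs` makes
the singularity at the origin square integrable. -/
theorem exists_dominating (hΦ : IsParabolicFamily σ δ s Φ) (hδ : 0 < δ) (hδσ : δ < σ / 2)
    (hn : 0 < n) (hs : 0 < n + 2 * (s - 2 * δ)) (k : ℕ) {t₀ : ℝ} (ht₀ : 0 < t₀) :
    ∃ b : EuclideanSpace ℝ (Fin n) → ℝ, MemLp b 2 volume ∧ ∀ t > t₀, ∀ ξ, ‖Φ k t ξ‖ ≤ b ξ := by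
  have hpi := Real.pi_pos
  obtain ⟨N₀, h⟩ := hΦ k
  obtain ⟨C, hC, h⟩ := h (max N₀ 0) (le_max_left _ _)
  set N := max N₀ 0
  have hN : 0 ≤ N := le_max_right _ _
  refine ⟨fun ξ => C * ((t₀ ^ k)⁻¹ * ((2 * Real.pi * ‖ξ‖) ^ (s - 2 * δ)
      * Real.exp (-(t₀ / 2 * (2 * Real.pi * ‖ξ‖) ^ (2 * (σ - δ)))))
      + (2 * Real.pi * ‖ξ‖) ^ N * Real.exp (-(t₀ / 20 * (2 * Real.pi * ‖ξ‖) ^ (2 * δ)))),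
    ?_, fun t ht ξ => ?_⟩
  · refine (((memLp_rpow_mul_exp_neg hn hs (by positivity) (by linarith)).const_mul _).add
      (memLp_rpow_mul_exp_neg hn ?_ (by positivity) (by positivity))).const_mul C
    have : (0 : ℝ) < n := by exact_mod_cast hn
    linarith
  · have ht' : 0 < t := ht₀.trans ht
    refine (h t ht' ξ).trans ?_
    dsimp only
    gcongr

theorem scaled_le (hΦ : IsParabolicFamily σ δ s Φ) (hδ : 0 < δ) (hδσ : δ < σ / 2)
    (hn : 0 < n) (hs : 0 < n + 2 * (s - 2 * δ)) (k : ℕ) {κ : ℝ} (hκ : κ = 1 / (2 * (σ - δ))) :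
    ∃ H : EuclideanSpace ℝ (Fin n) → ℝ, MemLp H 2 volume ∧ ∀ t ≥ 1, ∀ η,
      t ^ (κ * (s - 2 * δ) + k) * ‖Φ k t (t ^ (-κ) • η)‖ ≤ H η := by
  have hpi := Real.pi_pos
  have hp : 0 < 2 * (σ - δ) := by linarith
  have hne : σ - δ ≠ 0 := by rintro h; rw [h] at hp; linarith
  have hκ0 : 0 < κ := by rw [hκ]; positivity
  set l := κ * (s - 2 * δ) + k
  obtain ⟨N₀, h⟩ := hΦ k
  -- `N ≥ l/κ` makes `t^(l - κN) ≤ 1` for `t ≥ 1`, so the high-frequency summand stays bounded after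
  -- scaling.
  set N := max (max N₀ 0) (l / κ)
  have hN : 0 ≤ N := (le_max_right _ _).trans (le_max_left _ _)
  have hlN : l ≤ κ * N := by
    have : l / κ ≤ N := le_max_right _ _
    rw [div_le_iff₀ hκ0] at this
    linarith
  obtain ⟨C, hC, h⟩ := h N ((le_max_left _ _).trans (le_max_left _ _))
  refine ⟨fun η => C * ((2 * Real.pi * ‖η‖) ^ (s - 2 * δ)
      * Real.exp (-(1 / 2 * (2 * Real.pi * ‖η‖) ^ (2 * (σ - δ))))
      + (2 * Real.pi * ‖η‖) ^ N * Real.exp (-(1 / 20 * (2 * Real.pi * ‖η‖) ^ (2 * δ)))),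
    ?_, fun t ht η => ?_⟩
  · refine ((memLp_rpow_mul_exp_neg hn hs (by positivity) (by linarith)).add
      (memLp_rpow_mul_exp_neg hn ?_ (by positivity) (by positivity))).const_mul C
    have : (0 : ℝ) < n := by exact_mod_cast hn
    linarith
  · have ht0 : 0 < t := by linarith
    set ρ := 2 * Real.pi * ‖η‖
    have hρ : 0 ≤ ρ := by positivity
    have hr : 2 * Real.pi * ‖t ^ (-κ) • η‖ = t ^ (-κ) * ρ := by
      rw [norm_smul, Real.norm_of_nonneg (by positivity)]
      ring
    have hpow (x : ℝ) : (t ^ (-κ) * ρ) ^ x = t ^ (-κ * x) * ρ ^ x := by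
      rw [Real.mul_rpow (by positivity) hρ, ← Real.rpow_mul ht0.le]
    have hb := h t ht0 (t ^ (-κ) • η)
    rw [hr, hpow, hpow, hpow, hpow] at hb
    have e1 : t * t ^ (-κ * (2 * (σ - δ))) = 1 := by
      rw [show -κ * (2 * (σ - δ)) = -1 by rw [hκ]; field_simp, Real.rpow_neg_one]
      field_simp
    -- As `2δ ≤ 2(σ-δ)`, the second exponential decays after scaling at least as fast as at `t = 1`.
    have e2 : 1 ≤ t * t ^ (-κ * (2 * δ)) := by
      nth_rewrite 1 [← Real.rpow_one t]
      rw [← Real.rpow_add ht0]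
      refine Real.one_le_rpow ht ?_
      have : κ * (2 * δ) ≤ 1 := by
        rw [hκ, one_div_mul_eq_div, div_le_one hp]
        linarith
      linarith
    have e3 : t ^ l * ((t ^ k)⁻¹ * t ^ (-κ * (s - 2 * δ))) = 1 := by
      rw [← Real.rpow_natCast, ← Real.rpow_neg ht0.le, ← Real.rpow_add ht0, ← Real.rpow_add ht0]
      rw [show l + (-(k : ℝ) + -κ * (s - 2 * δ)) = 0 by simp only [l]; ring, Real.rpow_zero]
    have e4 : t ^ l * t ^ (-κ * N) ≤ 1 := by
      rw [← Real.rpow_add ht0]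
      exact Real.rpow_le_one_of_one_le_of_nonpos ht (by linarith)
    calc _ ≤ t ^ l * (C * ((t ^ k)⁻¹ * (t ^ (-κ * (s - 2 * δ)) * ρ ^ (s - 2 * δ)
          * Real.exp (-(t / 2 * (t ^ (-κ * (2 * (σ - δ))) * ρ ^ (2 * (σ - δ))))))
          + t ^ (-κ * N) * ρ ^ N * Real.exp (-(t / 20 * (t ^ (-κ * (2 * δ)) * ρ ^ (2 * δ)))))) := by
          gcongr
      _ = C * ((t ^ l * ((t ^ k)⁻¹ * t ^ (-κ * (s - 2 * δ)))) * (ρ ^ (s - 2 * δ)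
          * Real.exp (-(1 / 2 * ((t * t ^ (-κ * (2 * (σ - δ)))) * ρ ^ (2 * (σ - δ))))))
          + (t ^ l * t ^ (-κ * N)) * (ρ ^ N
          * Real.exp (-(1 / 20 * ((t * t ^ (-κ * (2 * δ))) * ρ ^ (2 * δ)))))) := by ring_nf
      _ ≤ C * (1 * (ρ ^ (s - 2 * δ) * Real.exp (-(1 / 2 * (1 * ρ ^ (2 * (σ - δ))))))
          + 1 * (ρ ^ N * Real.exp (-(1 / 20 * (1 * ρ ^ (2 * δ)))))) := by
          rw [e1, e3]
          gcongr
      _ = _ := by simp only [one_mul, ρ]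

/-- Smoothness and large time behaviour of `L²` functions whose Fourier transforms form
a parabolic family with a self-similar limit. -/
theorem contDiffOn_and_tendsto (hΦ : IsParabolicFamily σ δ s Φ) (hδ : 0 < δ) (hδσ : δ < σ / 2)
    (hn : 0 < n) (hs : 0 < n + 2 * (s - 2 * δ))
    (hd : ∀ k ξ t, 0 < t → HasDerivAt (fun τ => Φ k τ ξ) (Φ (k + 1) t ξ) t)
    (hm : ∀ k t, 0 < t → Measurable (Φ k t)) {f : ℝ → L2 n}
    (hf : ∀ t > 0, (𝓕 (f t) : L2 n) =ᵐ[volume] Φ 0 t) (k : ℕ) :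
    ContDiffOn ℝ k f (Ioi 0) ∧ ∀ (κ : ℝ) (Φ' : EuclideanSpace ℝ (Fin n) → ℂ),
      κ = 1 / (2 * (σ - δ)) →
      (∀ η ≠ 0, Tendsto (fun t : ℝ => ((t ^ (κ * (s - 2 * δ) + k) : ℝ) : ℂ)
        * Φ k t (t ^ (-κ) • η)) atTop (𝓝 (Φ' η))) →
      Tendsto (fun t : ℝ => (t ^ (κ * (s - 2 * δ) + k + κ * n / 2) * ‖iteratedDeriv k f t‖) ^ 2)
        atTop (𝓝 (∫ η, ‖Φ' η‖ ^ 2)) := by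
  have : Nonempty (Fin n) := ⟨⟨0, hn⟩⟩
  obtain ⟨h1, h2⟩ := contDiffOn_and_iteratedDeriv_of_dominated
    (Lp.fourierTransformₗᵢ (EuclideanSpace ℝ (Fin n)) ℂ) hd
    (fun k t ht => (hm k t ht).aestronglyMeasurable)
    (fun k t₀ ht₀ => hΦ.exists_dominating hδ hδσ hn hs k ht₀) hf k
  refine ⟨h1, fun κ Φ' hκ hlim => ?_⟩
  obtain ⟨H, hH, hH'⟩ := hΦ.scaled_le hδ hδσ hn hs k hκ
  have h := tendsto_rpow_mul_norm_sq_of_scaling (Ψ' := Φ') hH (hm k) h2 hH' ?_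
  · refine h.congr fun t => ?_
    rw [LinearIsometryEquiv.norm_map]
    rfl
  · filter_upwards [measure_eq_zero_iff_ae_notMem.1
      (measure_singleton (μ := volume) (0 : EuclideanSpace ℝ (Fin n)))] with η hη
    refine (hlim η hη).norm.congr' ?_
    filter_upwards [eventually_gt_atTop 0] with t ht
    rw [norm_mul, Complex.norm_real, Real.norm_of_nonneg (by positivity)]

end IsParabolicFamily

/-! ### The solution and the profile as parabolic families -/

section Families

variable {n : ℕ}

/-- Fourier transform of the `k`-th time derivative of `|D|^s u`. -/
def solFamily (σ δ s : ℝ) (y₀ y₁ : EuclideanSpace ℝ (Fin n) → ℂ) (k : ℕ) (t : ℝ)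
    (ξ : EuclideanSpace ℝ (Fin n)) : ℂ :=
  (((2 * Real.pi * ‖ξ‖) ^ s : ℝ) : ℂ) * fourierSol σ δ y₀ y₁ k t ξ

/-- Fourier transform of the `k`-th time derivative of `|D|^s` applied to the profile. -/
def profileFamily (n : ℕ) (σ δ s : ℝ) (k : ℕ) (t : ℝ) (ξ : EuclideanSpace ℝ (Fin n)) : ℂ :=
  (((2 * Real.pi * ‖ξ‖) ^ s : ℝ) : ℂ) *
    (((-(2 * Real.pi * ‖ξ‖) ^ (2 * (σ - δ))) ^ k
      * Real.exp (-t * (2 * Real.pi * ‖ξ‖) ^ (2 * (σ - δ)))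
      / (2 * Real.pi * ‖ξ‖) ^ (2 * δ) : ℝ) : ℂ)

theorem hasDerivAt_solFamily (σ δ s : ℝ) (y₀ y₁ : EuclideanSpace ℝ (Fin n) → ℂ) (k : ℕ)
    (ξ : EuclideanSpace ℝ (Fin n)) (t : ℝ) :
    HasDerivAt (fun τ => solFamily σ δ s y₀ y₁ k τ ξ) (solFamily σ δ s y₀ y₁ (k + 1) t ξ) t :=
  (hasDerivAt_dampedSol _ _ _ _ k t).const_mul _

theorem hasDerivAt_profileFamily (σ δ s : ℝ) (k : ℕ) (ξ : EuclideanSpace ℝ (Fin n)) (t : ℝ) :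
    HasDerivAt (fun τ => profileFamily n σ δ s k τ ξ) (profileFamily n σ δ s (k + 1) t ξ) t := by
  have h := ((hasDerivAt_id t).neg.mul_const ((2 * Real.pi * ‖ξ‖) ^ (2 * (σ - δ)))).exp
  have h2 := ((h.const_mul ((-(2 * Real.pi * ‖ξ‖) ^ (2 * (σ - δ))) ^ k)).div_const
    ((2 * Real.pi * ‖ξ‖) ^ (2 * δ))).ofReal_comp.const_mul (((2 * Real.pi * ‖ξ‖) ^ s : ℝ) : ℂ)
  refine h2.congr_deriv ?_
  rw [profileFamily]
  congr 2
  rw [pow_succ]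
  simp only [Pi.neg_apply, id]
  ring

theorem measurable_solFamily (σ δ s : ℝ) {y₀ y₁ : EuclideanSpace ℝ (Fin n) → ℂ}
    (h₀ : Measurable y₀) (h₁ : Measurable y₁) (k : ℕ) (t : ℝ) :
    Measurable (solFamily σ δ s y₀ y₁ k t) :=
  (Complex.measurable_ofReal.comp ((measurable_norm.const_mul _).pow_const s)).mul
    (measurable_fourierSol σ δ h₀ h₁ k t)

theorem measurable_profileFamily (σ δ s : ℝ) (k : ℕ) (t : ℝ) :
    Measurable (profileFamily n σ δ s k t) := by
  have h (β : ℝ) : Measurable fun ξ : EuclideanSpace ℝ (Fin n) => (2 * Real.pi * ‖ξ‖) ^ β :=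
    (measurable_norm.const_mul _).pow_const β
  exact (Complex.measurable_ofReal.comp (h s)).mul (Complex.measurable_ofReal.comp
    ((((h _).neg.pow_const k).mul (Real.measurable_exp.comp ((h _).const_mul _))).div (h _)))

theorem isParabolicFamily_solFamily {σ δ s M : ℝ} (hδ : 0 < δ) (hδσ : δ < σ / 2)
    {y₀ y₁ : EuclideanSpace ℝ (Fin n) → ℂ} (h₀ : ∀ ξ, ‖y₀ ξ‖ ≤ M) (h₁ : ∀ ξ, ‖y₁ ξ‖ ≤ M) :
    IsParabolicFamily σ δ s (solFamily σ δ s y₀ y₁) := by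
  have hpi := Real.pi_pos
  have hM : 0 ≤ M := (norm_nonneg _).trans (h₀ 0)
  refine fun k => ⟨2 * σ * (k + 1) + s, fun N hN => ?_⟩
  obtain ⟨C, hC, h⟩ := exists_rpow_mul_norm_dampedSol_le hδ hδσ k hN
  refine ⟨C * M, by positivity, fun t ht ξ => ?_⟩
  rcases eq_or_ne ξ 0 with rfl | hξ
  · rw [solFamily, fourierSol_at_zero hδ (by linarith), mul_zero, norm_zero]
    positivity
  · have hr : 0 < 2 * Real.pi * ‖ξ‖ := by
      have : 0 < ‖ξ‖ := norm_pos_iff.2 hξ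
      positivity
    rw [solFamily, norm_mul, Complex.norm_real, Real.norm_of_nonneg (by positivity)]
    exact h M _ _ (h₀ ξ) (h₁ ξ) _ t hr ht

/-- The low-frequency summand suffices: half of the exponential absorbs the powers of `t r^(2(σ-δ))`
created by differentiation. -/
theorem isParabolicFamily_profileFamily {σ δ : ℝ} (s : ℝ) (hδ : 0 < δ) :
    IsParabolicFamily σ δ s (profileFamily n σ δ s) := by
  have hpi := Real.pi_pos
  refine fun k => ⟨0, fun N _ => ⟨4 ^ k * k.factorial, by positivity, fun t ht ξ => ?_⟩⟩
  rcases eq_or_ne ξ 0 with rfl | hξ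
  · rw [profileFamily]
    have : (2 * Real.pi * ‖(0 : EuclideanSpace ℝ (Fin n))‖) ^ (2 * δ) = 0 := by
      rw [norm_zero, mul_zero, Real.zero_rpow (by positivity)]
    rw [this, div_zero, Complex.ofReal_zero, mul_zero, norm_zero]
    positivity
  · have hr : 0 < 2 * Real.pi * ‖ξ‖ := by
      have : 0 < ‖ξ‖ := norm_pos_iff.2 hξ
      positivity
    set r := 2 * Real.pi * ‖ξ‖
    set x := t / 2 * r ^ (2 * (σ - δ))
    have hx : 0 ≤ x := by positivity
    have hk := pow_mul_exp_neg_le k hx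
    have h1 : t ^ k * ((r ^ (2 * (σ - δ))) ^ k * Real.exp (-t * r ^ (2 * (σ - δ))))
        ≤ 4 ^ k * k.factorial * Real.exp (-x) := by
      refine le_trans ?_ hk
      rw [← mul_assoc, ← mul_pow, show -t * r ^ (2 * (σ - δ)) = -(2 * x) by simp only [x]; ring]
      have : 0 ≤ t * r ^ (2 * (σ - δ)) := by positivity
      gcongr ?_ ^ k * _
      linarith [show x = t / 2 * r ^ (2 * (σ - δ)) from rfl]
    have h2 : (r ^ (2 * (σ - δ))) ^ k * Real.exp (-t * r ^ (2 * (σ - δ)))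
        ≤ (t ^ k)⁻¹ * (4 ^ k * k.factorial * Real.exp (-x)) := by
      rw [inv_mul_eq_div, le_div_iff₀ (by positivity), mul_comm]
      exact h1
    rw [profileFamily, norm_mul, Complex.norm_real, Complex.norm_real, norm_div, norm_mul, norm_pow,
      norm_neg, Real.norm_of_nonneg (by positivity), Real.norm_of_nonneg (by positivity),
      Real.norm_of_nonneg (by positivity), Real.norm_of_nonneg (by positivity)]
    calc _ ≤ r ^ s * ((t ^ k)⁻¹ * (4 ^ k * k.factorial * Real.exp (-x)) / r ^ (2 * δ)) := by gcongr
      _ = 4 ^ k * k.factorial * ((t ^ k)⁻¹ * (r ^ (s - 2 * δ) * Real.exp (-x)) + 0) := by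
        rw [Real.rpow_sub hr]
        ring
      _ ≤ _ := by
        gcongr
        positivity

/-- The choice of `κ` makes `t r^(2(σ-δ))` scale invariant, and the remaining powers of `t` cancel.
At the origin both sides vanish through division by zero. -/
theorem rpow_mul_profileFamily_scaled {σ δ s κ : ℝ} (hδσ : δ < σ / 2) (hδ : 0 < δ)
    (hκ : κ = 1 / (2 * (σ - δ))) (k : ℕ) {t : ℝ} (ht : 0 < t) (η : EuclideanSpace ℝ (Fin n)) :
    ((t ^ (κ * (s - 2 * δ) + k) : ℝ) : ℂ) * profileFamily n σ δ s k t (t ^ (-κ) • η)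
      = profileFamily n σ δ s k 1 η := by
  have hpi := Real.pi_pos
  have hp : 0 < 2 * (σ - δ) := by linarith
  have hne : σ - δ ≠ 0 := by rintro h; rw [h] at hp; linarith
  set ρ := 2 * Real.pi * ‖η‖
  have hρ : 0 ≤ ρ := by positivity
  have hr : 2 * Real.pi * ‖t ^ (-κ) • η‖ = t ^ (-κ) * ρ := by
    rw [norm_smul, Real.norm_of_nonneg (by positivity)]
    ring
  have hpow (x : ℝ) : (t ^ (-κ) * ρ) ^ x = t ^ (-κ * x) * ρ ^ x := by
    rw [Real.mul_rpow (by positivity) hρ, ← Real.rpow_mul ht.le]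
  have e1 : t ^ (-κ * (2 * (σ - δ))) = t⁻¹ := by
    rw [show -κ * (2 * (σ - δ)) = -1 by rw [hκ]; field_simp, Real.rpow_neg_one]
  rw [profileFamily, profileFamily, hr, hpow, hpow, hpow, e1, ← Complex.ofReal_mul,
    ← Complex.ofReal_mul, ← Complex.ofReal_mul]
  congr 1
  have e2 : t ^ (κ * (s - 2 * δ) + k) = t ^ k * (t ^ (-κ * (2 * δ)) / t ^ (-κ * s)) := by
    rw [Real.rpow_add ht, Real.rpow_natCast, ← Real.rpow_sub ht, mul_comm]
    congr 2
    ring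
  have h1 : 0 < t ^ (-κ * s) := by positivity
  have h2 : 0 < t ^ (-κ * (2 * δ)) := by positivity
  rw [show 2 * Real.pi * ‖η‖ = ρ from rfl, e2, show -t * (t⁻¹ * ρ ^ (2 * (σ - δ))) = -1 * ρ ^ (2 * (σ - δ)) by field_simp,
    show -(t⁻¹ * ρ ^ (2 * (σ - δ))) = t⁻¹ * (-ρ ^ (2 * (σ - δ))) by ring, mul_pow, inv_pow]
  rcases hρ.eq_or_lt with h0 | h0
  · rw [← h0, Real.zero_rpow (by positivity : 2 * δ ≠ 0), mul_zero, div_zero, div_zero,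
      mul_zero, mul_zero, mul_zero]
  · field_simp

/-- In self-similar variables the solution converges to the profile. -/
theorem tendsto_rpow_mul_solFamily_scaled {σ δ s κ : ℝ} (hδσ : δ < σ / 2) (hδ : 0 < δ)
    (hκ : κ = 1 / (2 * (σ - δ))) {y₀ y₁ : EuclideanSpace ℝ (Fin n) → ℂ} (h₀ : Continuous y₀)
    (h₁ : Continuous y₁) (k : ℕ) {η : EuclideanSpace ℝ (Fin n)} (hη : η ≠ 0) :
    Tendsto (fun t : ℝ => ((t ^ (κ * (s - 2 * δ) + k) : ℝ) : ℂ)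
        * solFamily σ δ s y₀ y₁ k t (t ^ (-κ) • η)) atTop
      (𝓝 (y₁ 0 * profileFamily n σ δ s k 1 η)) := by
  have hpi := Real.pi_pos
  have hp : 0 < 2 * (σ - δ) := by linarith
  have hne : σ - δ ≠ 0 := by rintro h; rw [h] at hp; linarith
  have hκ0 : 0 < κ := by rw [hκ]; positivity
  have hη0 : 0 < ‖η‖ := norm_pos_iff.2 hη
  set ρ := 2 * Real.pi * ‖η‖
  have hρ : 0 < ρ := by positivity
  have hr (t : ℝ) (ht : 0 < t) : 2 * Real.pi * ‖t ^ (-κ) • η‖ = t ^ (-κ) * ρ := by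
    rw [norm_smul, Real.norm_of_nonneg (by positivity)]
    ring
  have hpow (t : ℝ) (ht : 0 < t) (x : ℝ) : (t ^ (-κ) * ρ) ^ x = t ^ (-κ * x) * ρ ^ x := by
    rw [Real.mul_rpow (by positivity) hρ.le, ← Real.rpow_mul ht.le]
  have hto : Tendsto (fun t : ℝ => t ^ (-κ)) atTop (𝓝 0) := tendsto_rpow_neg_atTop hκ0
  have hto2 (x : ℝ) (hx : 0 < x) : Tendsto (fun t : ℝ => (t ^ (-κ) * ρ) ^ x) atTop (𝓝 0) := by
    have h := (hto.mul_const ρ).rpow_const (p := x) (Or.inr hx.le)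
    rwa [zero_mul, Real.zero_rpow hx.ne'] at h
  have hsmul : Tendsto (fun t : ℝ => t ^ (-κ) • η) atTop (𝓝 0) := by
    simpa using hto.smul_const η
  have hab (t : ℝ) (ht : 0 < t) : (t ^ (-κ) * ρ) ^ (2 * σ) / ((t ^ (-κ) * ρ) ^ (2 * δ)) ^ 2
      = (t ^ (-κ) * ρ) ^ (2 * σ - 4 * δ) := by
    have hr0 : 0 < t ^ (-κ) * ρ := by positivity
    rw [← Real.rpow_mul_natCast hr0.le, ← Real.rpow_sub hr0]
    congr 1
    push_cast
    ring
  -- By the choice of `κ`, `t b/a` equals `ρ^(2(σ-δ))` exactly, while `2κδ < 1` forces `t a → ∞`: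
  -- the fast mode dies out.
  have hmain := tendsto_dampedSol (l := atTop) (a := fun t : ℝ => (t ^ (-κ) * ρ) ^ (2 * δ))
    (b := fun t => (t ^ (-κ) * ρ) ^ (2 * σ)) (t := fun t => t) (y₀ := fun t => y₀ (t ^ (-κ) • η))
    (y₁ := fun t => y₁ (t ^ (-κ) • η)) (c₀ := y₀ 0) (c₁ := y₁ 0) (τ := ρ ^ (2 * (σ - δ)))
    (by
      filter_upwards [eventually_gt_atTop 0] with t ht
      positivity)
    (hto2 _ (by positivity))
    ((hto2 (2 * σ - 4 * δ) (by linarith)).congr' (by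
      filter_upwards [eventually_gt_atTop 0] with t ht
      rw [hab t ht]))
    (by
      have he : 0 < 1 - κ * (2 * δ) := by
        have : κ * (2 * δ) < 1 := by
          rw [hκ, one_div_mul_eq_div, div_lt_one hp]
          linarith
        linarith
      have := (tendsto_rpow_atTop he).atTop_mul_const (by positivity : 0 < ρ ^ (2 * δ))
      refine this.congr' ?_
      filter_upwards [eventually_gt_atTop 0] with t ht
      rw [hpow t ht, ← mul_assoc t, Real.rpow_sub ht, Real.rpow_one, neg_mul, Real.rpow_neg ht.le,
        div_eq_mul_inv])
    (by
      filter_upwards [eventually_gt_atTop 0] with t ht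
      have hr0 : 0 < t ^ (-κ) * ρ := by positivity
      rw [← Real.rpow_sub hr0, hpow t ht, show -κ * (2 * σ - 2 * δ) = -1 by rw [hκ]; field_simp,
        Real.rpow_neg_one, ← mul_assoc, mul_inv_cancel₀ ht.ne', one_mul]
      congr 1
      ring)
    ((h₀.tendsto 0).comp hsmul) ((h₁.tendsto 0).comp hsmul) k
  have hmain2 := hmain.const_mul ((ρ ^ (s - 2 * δ) : ℝ) : ℂ)
  have hlim : ((ρ ^ (s - 2 * δ) : ℝ) : ℂ) * (y₁ 0 * (((-ρ ^ (2 * (σ - δ))) ^ k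
      * Real.exp (-ρ ^ (2 * (σ - δ))) : ℝ) : ℂ)) = y₁ 0 * profileFamily n σ δ s k 1 η := by
    rw [profileFamily, ← Complex.ofReal_mul, mul_left_comm, ← Complex.ofReal_mul, neg_one_mul,
      Real.rpow_sub hρ]
    congr 2
    ring
  rw [hlim] at hmain2
  refine hmain2.congr' ?_
  filter_upwards [eventually_gt_atTop 0] with t ht
  rw [solFamily, fourierSol, hr t ht]
  clear_value ρ
  rw [← mul_assoc, ← mul_assoc, ← Complex.ofReal_mul, ← Complex.ofReal_mul]
  congr 2
  rw [hpow t ht, hpow t ht, Real.rpow_sub hρ, Real.rpow_add ht, Real.rpow_natCast,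
    show κ * (s - 2 * δ) = -κ * (2 * δ) - -κ * s by ring, Real.rpow_sub ht]
  have h1 : 0 < t ^ (-κ * s) := by positivity
  field_simp

/-- The symbol is nonzero away from the origin, so the integrand is positive on an open nonempty
set. -/
theorem integral_norm_sq_profileFamily_pos {σ δ s : ℝ} (hδ : 0 < δ) (hδσ : δ < σ / 2) (hn : 0 < n)
    (hs : 0 < n + 2 * (s - 2 * δ)) (k : ℕ) {c : ℂ} (hc : c ≠ 0) :
    0 < ∫ η, ‖c * profileFamily n σ δ s k 1 η‖ ^ 2 := by
  have hpi := Real.pi_pos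
  have : Nonempty (Fin n) := ⟨⟨0, hn⟩⟩
  obtain ⟨b, hb, hb'⟩ := (isParabolicFamily_profileFamily (n := n) (σ := σ) s hδ).exists_dominating
    hδ hδσ hn hs k (t₀ := 1 / 2) (by norm_num)
  have hmem : MemLp (profileFamily n σ δ s k 1) 2 volume :=
    hb.mono' (measurable_profileFamily σ δ s k 1).aestronglyMeasurable
      (ae_of_all _ fun ξ => hb' 1 (by norm_num) ξ)
  rw [integral_pos_iff_support_of_nonneg (fun η => sq_nonneg _)
    (hmem.const_mul c).norm.integrable_sq]
  have hsub : ({0}ᶜ : Set (EuclideanSpace ℝ (Fin n)))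
      ⊆ Function.support fun η => ‖c * profileFamily n σ δ s k 1 η‖ ^ 2 := by
    intro η hη
    have hη0 : 0 < ‖η‖ := norm_pos_iff.2 hη
    have hρ : 0 < 2 * Real.pi * ‖η‖ := by positivity
    have h1 : (((2 * Real.pi * ‖η‖) ^ s : ℝ) : ℂ) ≠ 0 :=
      Complex.ofReal_ne_zero.2 (by positivity)
    have h2 : (((-(2 * Real.pi * ‖η‖) ^ (2 * (σ - δ))) ^ k
        * Real.exp (-1 * (2 * Real.pi * ‖η‖) ^ (2 * (σ - δ)))
        / (2 * Real.pi * ‖η‖) ^ (2 * δ) : ℝ) : ℂ) ≠ 0 := by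
      refine Complex.ofReal_ne_zero.2 (div_ne_zero (mul_ne_zero (pow_ne_zero k (neg_ne_zero.2 ?_))
        (Real.exp_pos _).ne') ?_) <;> positivity
    exact pow_ne_zero 2 (norm_ne_zero_iff.2 (mul_ne_zero hc (mul_ne_zero h1 h2)))
  refine lt_of_lt_of_le ?_ (measure_mono hsub)
  exact isOpen_compl_singleton.measure_pos volume
    ((exists_ne (0 : EuclideanSpace ℝ (Fin n))).imp fun x hx => hx)

end Families

end

/-! ### Assembly of the asymptotics -/

theorem theorem1p1 (n : ℕ) (σ δ₁ s : ℝ) (j : ℕ)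
    (hσ : 1 ≤ σ) (hδ₁ : 0 < δ₁) (hδ₁σ : δ₁ < σ / 2) (hj : j = 0 ∨ j = 1) (hs : 0 ≤ s)
    (hn : 4 * δ₁ < n)
    (u₀ u₁ : L2 n)
    (hu₀_int : Integrable (u₀ : EuclideanSpace ℝ (Fin n) → ℂ) volume)
    (hu₁_int : Integrable (u₁ : EuclideanSpace ℝ (Fin n) → ℂ) volume)
    (hu₀_sob : TemperedDistribution.MemSobolev (s + j * σ) 2
      (u₀ : 𝓢'(EuclideanSpace ℝ (Fin n), ℂ)))
    (hu₁_sob : TemperedDistribution.MemSobolev (max (s + ((j : ℝ) - 1) * σ) 0) 2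
      (u₁ : 𝓢'(EuclideanSpace ℝ (Fin n), ℂ)))
    (P₁ : ℂ) (hP₁ : P₁ = ∫ x, u₁ x)
    (rate : ℝ)
    (hrate : rate = -(n / (4 * (σ - δ₁))) - s / (2 * (σ - δ₁)) - j + δ₁ / (σ - δ₁))
    (u : ℝ → L2 n) (hu : IsSobolevSolution σ δ₁ u₀ u₁ u) :
    -- all the objects in the estimates below are well defined for `t > 0`
    (∀ t : ℝ, 0 < t → InDomAbsD s (u t) ∧ InDomAbsD s (profile n σ δ₁ t)) ∧
    ContDiffOn ℝ j (fun t => absD s (u t)) (Ioi 0) ∧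
    ContDiffOn ℝ j (fun t => absD s (profile n σ δ₁ t)) (Ioi 0) ∧
    -- asymptotic profile
    (fun t : ℝ => ‖iteratedDeriv j (fun τ => absD s (u τ - P₁ • profile n σ δ₁ τ)) t‖)
      =o[atTop] (fun t : ℝ => t ^ rate) ∧
    -- optimality of the decay rate
    (P₁ ≠ 0 → ∃ C₁ > 0, ∃ C₂ > 0, ∀ᶠ t : ℝ in atTop,
      C₁ * t ^ rate ≤ ‖iteratedDeriv j (fun τ => absD s (u τ)) t‖ ∧
      ‖iteratedDeriv j (fun τ => absD s (u τ)) t‖ ≤ C₂ * t ^ rate) := by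
  have hn0 : 0 < n := by
    have : (0 : ℝ) < n := by linarith
    exact_mod_cast this
  have hns : 0 < n + 2 * (s - 2 * δ₁) := by linarith
  -- Integrability of the data gives bounded continuous representatives, so that the value at zero
  -- frequency makes sense and equals the mean.
  set y₀ : EuclideanSpace ℝ (Fin n) → ℂ := 𝓕 (u₀ : EuclideanSpace ℝ (Fin n) → ℂ)
  set y₁ : EuclideanSpace ℝ (Fin n) → ℂ := 𝓕 (u₁ : EuclideanSpace ℝ (Fin n) → ℂ)
  have hc₀ : Continuous y₀ := continuous_fourierIntegral hu₀_int
  have hc₁ : Continuous y₁ := continuous_fourierIntegral hu₁_int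
  have hy₁ : y₁ 0 = P₁ := (fourierIntegral_zero _).trans hP₁.symm
  set M := max (∫ x, ‖u₀ x‖) (∫ x, ‖u₁ x‖)
  have hSol : IsParabolicFamily σ δ₁ s (solFamily σ δ₁ s y₀ y₁) :=
    isParabolicFamily_solFamily (M := M) hδ₁ hδ₁σ
      (fun ξ => (norm_fourierIntegral_le _ ξ).trans (le_max_left _ _))
      (fun ξ => (norm_fourierIntegral_le _ ξ).trans (le_max_right _ _))
  have hProf : IsParabolicFamily σ δ₁ s (profileFamily n σ δ₁ s) :=
    isParabolicFamily_profileFamily s hδ₁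
  have hSolm (k : ℕ) (t : ℝ) : Measurable (solFamily σ δ₁ s y₀ y₁ k t) :=
    measurable_solFamily σ δ₁ s hc₀.measurable hc₁.measurable k t
  have hProfm (k : ℕ) (t : ℝ) : Measurable (profileFamily n σ δ₁ s k t) :=
    measurable_profileFamily σ δ₁ s k t
  have hdom {t : ℝ} {Φ : ℕ → ℝ → EuclideanSpace ℝ (Fin n) → ℂ} (hΦ : IsParabolicFamily σ δ₁ s Φ)
      (hm : Measurable (Φ 0 t)) (ht : 0 < t) {f : L2 n}
      (hf : absDMultiplied s f =ᵐ[volume] Φ 0 t) : InDomAbsD s f := by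
    obtain ⟨b, hb, hb'⟩ := hΦ.exists_dominating hδ₁ hδ₁σ hn0 hns 0 (half_pos ht)
    exact (memLp_congr_ae hf).2 (hb.mono' hm.aestronglyMeasurable
      (ae_of_all _ fun ξ => hb' t (half_lt_self ht) ξ))
  have hfu (t : ℝ) (ht : 0 < t) :
      absDMultiplied s (u t) =ᵐ[volume] solFamily σ δ₁ s y₀ y₁ 0 t := by
    filter_upwards [fourier_ae_eq_fourierSol hδ₁ hδ₁σ hn0 hu hc₀.measurable hc₁.measurable
      (fourier_ae_eq_fourierIntegral u₀ hu₀_int) (fourier_ae_eq_fourierIntegral u₁ hu₁_int) ht.le]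
      with ξ hξ
    rw [absDMultiplied, hξ, solFamily]
  have hfp (t : ℝ) (ht : 0 < t) :
      absDMultiplied s (profile n σ δ₁ t) =ᵐ[volume] profileFamily n σ δ₁ s 0 t := by
    filter_upwards [fourier_profile hδ₁ hδ₁σ hn ht] with ξ hξ
    rw [absDMultiplied, hξ, profileSymbol, profileFamily, pow_zero, one_mul]
  have hfd (t : ℝ) (ht : 0 < t) : absDMultiplied s (u t - P₁ • profile n σ δ₁ t) =ᵐ[volume]
      fun ξ => solFamily σ δ₁ s y₀ y₁ 0 t ξ - P₁ * profileFamily n σ δ₁ s 0 t ξ := by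
    have hF : (𝓕 (u t - P₁ • profile n σ δ₁ t) : L2 n)
        = 𝓕 (u t) - P₁ • (𝓕 (profile n σ δ₁ t) : L2 n) := by
      exact ((Lp.fourierTransformₗᵢ (EuclideanSpace ℝ (Fin n)) ℂ).map_sub _ _).trans
        (congrArg _ ((Lp.fourierTransformₗᵢ (EuclideanSpace ℝ (Fin n)) ℂ).map_smul _ _))
    filter_upwards [hfu t ht, hfp t ht,
      Lp.coeFn_sub (𝓕 (u t) : L2 n) (P₁ • (𝓕 (profile n σ δ₁ t) : L2 n)),
      Lp.coeFn_smul P₁ (𝓕 (profile n σ δ₁ t) : L2 n)] with ξ e1 e2 e3 e4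
    rw [← e1, ← e2, absDMultiplied, absDMultiplied, absDMultiplied, hF, e3, Pi.sub_apply, e4,
      Pi.smul_apply, smul_eq_mul]
    ring
  have hDiff := hSol.sub_const_mul hProf P₁
  have hDiffm (k : ℕ) (t : ℝ) : Measurable fun ξ =>
      solFamily σ δ₁ s y₀ y₁ k t ξ - P₁ * profileFamily n σ δ₁ s k t ξ :=
    (hSolm k t).sub ((hProfm k t).const_mul P₁)
  have hdu (t : ℝ) (ht : 0 < t) : InDomAbsD s (u t) := hdom hSol (hSolm 0 t) ht (hfu t ht)
  have hdp (t : ℝ) (ht : 0 < t) : InDomAbsD s (profile n σ δ₁ t) :=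
    hdom hProf (hProfm 0 t) ht (hfp t ht)
  have hdd (t : ℝ) (ht : 0 < t) : InDomAbsD s (u t - P₁ • profile n σ δ₁ t) :=
    hdom hDiff (hDiffm 0 t) ht (hfd t ht)
  obtain ⟨hu1, hu2⟩ := hSol.contDiffOn_and_tendsto hδ₁ hδ₁σ hn0 hns
    (fun k ξ t _ => hasDerivAt_solFamily σ δ₁ s y₀ y₁ k ξ t) (fun k t _ => hSolm k t)
    (f := fun t => absD s (u t)) (fun t ht => (fourier_absD (hdu t ht)).trans (hfu t ht)) j
  obtain ⟨hp1, -⟩ := hProf.contDiffOn_and_tendsto hδ₁ hδ₁σ hn0 hns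
    (fun k ξ t _ => hasDerivAt_profileFamily σ δ₁ s k ξ t) (fun k t _ => hProfm k t)
    (f := fun t => absD s (profile n σ δ₁ t))
    (fun t ht => (fourier_absD (hdp t ht)).trans (hfp t ht)) j
  obtain ⟨-, hd2⟩ := hDiff.contDiffOn_and_tendsto hδ₁ hδ₁σ hn0 hns
    (fun k ξ t _ => (hasDerivAt_solFamily σ δ₁ s y₀ y₁ k ξ t).sub
      ((hasDerivAt_profileFamily σ δ₁ s k ξ t).const_mul P₁)) (fun k t _ => hDiffm k t)
    (f := fun t => absD s (u t - P₁ • profile n σ δ₁ t))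
    (fun t ht => (fourier_absD (hdd t ht)).trans (hfd t ht)) j
  set κ := 1 / (2 * (σ - δ₁)) with hκ
  have hne : σ - δ₁ ≠ 0 := by
    have : 0 < σ - δ₁ := by linarith
    exact this.ne'
  have hrate' : κ * (s - 2 * δ₁) + j + κ * n / 2 = -rate := by
    rw [hrate, hκ]
    field_simp
    ring
  have hlimu (η : EuclideanSpace ℝ (Fin n)) (hη : η ≠ 0) :=
    tendsto_rpow_mul_solFamily_scaled (s := s) hδ₁σ hδ₁ hκ hc₀ hc₁ j hη
  have hlimd (η : EuclideanSpace ℝ (Fin n)) (hη : η ≠ 0) :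
      Tendsto (fun t : ℝ => ((t ^ (κ * (s - 2 * δ₁) + j) : ℝ) : ℂ) *
        (solFamily σ δ₁ s y₀ y₁ j t (t ^ (-κ) • η)
          - P₁ * profileFamily n σ δ₁ s j t (t ^ (-κ) • η))) atTop (𝓝 0) := by
    -- By exact self-similarity the rescaled profile is constant in `t`, so it may be subtracted as
    -- a constant from the limit.
    have h := (hlimu η hη).sub_const (P₁ * profileFamily n σ δ₁ s j 1 η)
    rw [hy₁, sub_self] at h
    refine h.congr' ?_
    filter_upwards [eventually_gt_atTop 0] with t ht
    rw [← rpow_mul_profileFamily_scaled hδ₁σ hδ₁ hκ j ht η]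
    ring
  have hU := hu2 κ _ hκ hlimu
  have hD := hd2 κ (fun _ => 0) hκ hlimd
  rw [hrate'] at hU hD
  refine ⟨fun t ht => ⟨hdu t ht, hdp t ht⟩, hu1, hp1, ?_, fun hP => ?_⟩
  · simp only [norm_zero, ne_eq, OfNat.ofNat_ne_zero, not_false_eq_true, zero_pow,
      integral_zero] at hD
    have hD' := hD.sqrt
    rw [Real.sqrt_zero] at hD'
    refine (Asymptotics.isLittleO_iff_tendsto' ?_).2 (hD'.congr' ?_)
    · filter_upwards [eventually_gt_atTop 0] with t ht h0
      exact absurd h0 (by positivity)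
    · filter_upwards [eventually_gt_atTop 0] with t ht
      rw [Real.sqrt_sq (by positivity), Real.rpow_neg ht.le, inv_mul_eq_div]
  · rw [hy₁] at hU
    have hV := integral_norm_sq_profileFamily_pos hδ₁ hδ₁σ hn0 hns j hP
    set V := ∫ η, ‖P₁ * profileFamily n σ δ₁ s j 1 η‖ ^ 2
    have hU' := hU.sqrt
    have hV' : 0 < √V := Real.sqrt_pos.2 hV
    -- The norm divided by `t ^ rate` tends to `√V > 0`, so it is eventually between `√V / 2` and `2
    -- √V`.
    refine ⟨√V / 2, by positivity, 2 * √V, by positivity, ?_⟩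
    filter_upwards [eventually_gt_atTop 0, hU'.eventually_const_lt (half_lt_self hV'),
      hU'.eventually_lt_const (by linarith : √V < 2 * √V)] with t ht h1 h2
    rw [Real.sqrt_sq (by positivity), Real.rpow_neg ht.le, inv_mul_eq_div] at h1 h2
    have ht' : 0 < t ^ rate := by positivity
    exact ⟨((lt_div_iff₀ ht').1 h1).le, ((div_lt_iff₀ ht').1 h2).le⟩
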